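/- Let $\gamma,\alpha>0$, $\sigma\neq 0$, $h>0$, and let $(x_t,y_t)_{t\ge 0}$ be a stationary solution of the linear Langevin system $$dx=y\,dt,\qquad dy=(-\gamma y-\alpha x)\,dt+\sigma\,dB_t,$$ where $B$ is a standard Brownian motion independent of $(x_0,y_0)$. Put $\mathbf A=\begin{pmatrix}0&1\\-\alpha&-\gamma\end{pmatrix}$, $a_1=\operatorname{trace}(e^{\mathbf A h})$, $a_2=-e^{-\gamma h}$, and assume $(e^{\mathbf A h})_{12}\neq 0$. Let $\gamma_j=\operatorname{Cov}(x_{kh},x_{(k+j)h})$ be the autocovariances of the sampled process $\{x_{nh}\}_{n\ge0}$; they do not depend on $k$, and $\gamma_0=\frac{\sigma^2}{2\alpha\gamma}$, $$\gamma_j=\gamma_0\,\frac{\lambda_1e^{\lambda_2jh}-\lambda_2e^{\lambda_1jh}}{\lambda_1-\lambda_2}\ \text{ if }\gamma^2\ne4\alpha,\qquad \gamma_j=\gamma_0\,e^{\lambda_0jh}(1-\lambda_0jh)\ \text{ if }\gamma^2=4\alpha,$$ where $\lambda_1\ne\lambda_2$ are the complex roots of $\lambda^2+\gamma\lambda+\alpha=0$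 in the first case and $\lambda_0=-\gamma/2$ in the second. An ARMA$(p,q)$ process with mean $\mu$ is a process $\{X_n\}_{n\in\mathbb Z}$ such that $\tilde X_n=X_n-\mu$ is stationary and satisfies $\tilde X_n-\phi_1\tilde X_{n-1}-\dots-\phi_p\tilde X_{n-p}=W_n+\theta_1W_{n-1}+\dots+\theta_qW_{n-q}$ for all $n$, with $W_n$ i.i.d. $\mathcal N(0,\sigma_W^2)$ and with $\phi(z)=1-\phi_1z-\dots-\phi_pz^p$ and $\theta(z)=1+\theta_1z+\dots+\theta_qz^q$ having no common factor (leading coefficients may vanish). It is causal (invertible) if $\phi$ (resp. $\theta$) has no zero in $\{|z|\le1\}$. Then there is exactly one pair $(\theta_1,\sigma_W^2)$ of real numbers with $|\theta_1|<1$ and $$\sigma_W^2(1+\theta_1^2+\theta_1a_1)=\gamma_0-\gamma_1a_1-\gamma_2a_2,\qquad \sigma_W^2\theta_1=\gamma_1(1-a_2)-\gamma_0a_1,$$ and it has $\sigma_W^2>0$. There is a causal, invertible, mean-zero ARMA$(2,1)$ process $$X_{n+2}=a_1X_{n+1}+a_2X_n+W_n+\theta_1W_{n-1},\qquad W_n\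 \text{i.i.d.}\ \mathcal N(0,\sigma_W^2),$$ such that $\{X_n\}_{n\ge0}$ has the same law as $\{x_{nh}\}_{n\ge0}$. Moreover, a causal invertible ARMA process of any orders and any mean has the same law as $\{x_{nh}\}$ if and only if it has mean $0$, noise variance $\sigma_W^2$, and polynomials $\phi(z)=1-a_1z-a_2z^2$ and $\theta(z)=1+\theta_1z$. -/

import Mathlib

open MeasureTheory ProbabilityTheory
open scoped NNReal

noncomputable section

/-- Strict stationarity of a process indexed by an additive monoid of times: all finite-dimensional
distributions are invariant under every time shift. -/
def IsStrictlyStationary {T Ω E : Type*} [Add T] [MeasurableSpace Ω] [MeasurableSpace E]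
    (X : T → Ω → E) (P : Measure Ω) : Prop :=
  ∀ (I : Finset T) (s : T),
    IdentDistrib (fun ω (t : I) => X (t + s) ω) (fun ω (t : I) => X t ω) P P

/-! ### The linear Langevin system -/

/-- The drift matrix `A` of the linear Langevin system `dx = y dt`,
`dy = (-γ y - α x) dt + σ dB`. -/
def langevinMatrix (γ α : ℝ) : Matrix (Fin 2) (Fin 2) ℝ :=
  !![0, 1; -α, -γ]

/-- The matrix exponential `exp (h A)`. -/
def langevinPropagator (γ α h : ℝ) : Matrix (Fin 2) (Fin 2) ℝ :=
  NormedSpace.exp (h • langevinMatrix γ α)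

/-- `(x, y)` is a stationary solution on `[0, ∞)` of the linear Langevin system
`dx = y dt`, `dy = (-γ y - α x) dt + σ dB`, driven by the standard Brownian motion `B`.
As the noise is additive, the stochastic differential equation is the pathwise integral equation
below. -/
structure IsStationaryLangevin {Ω : Type*} [MeasurableSpace Ω] (γ α σ : ℝ)
    (x y B : ℝ≥0 → Ω → ℝ) (P : Measure Ω) : Prop where
  brownian : IsBrownianReal B P
  indep : IndepFun (fun ω => (x 0 ω, y 0 ω)) (fun ω t => B t ω) P
  cont : ∀ᵐ ω ∂P, Continuous (fun t => x t ω) ∧ Continuous (fun t => y t ω)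
  eq_x : ∀ᵐ ω ∂P, ∀ t : ℝ≥0, x t ω = x 0 ω + ∫ s in (0 : ℝ)..t, y s.toNNReal ω
  eq_y : ∀ᵐ ω ∂P, ∀ t : ℝ≥0,
    y t ω = y 0 ω + (∫ s in (0 : ℝ)..t, (-γ * y s.toNNReal ω - α * x s.toNNReal ω)) + σ * B t ω
  stationary : IsStrictlyStationary (fun t ω => (x t ω, y t ω)) P

/-- The autocovariance at lag `j` of the sampled process `(x_{n h})_n`. -/
def sampledAutocov {Ω : Type*} [MeasurableSpace Ω] (x : ℝ≥0 → Ω → ℝ) (h : ℝ≥0) (P : Measure Ω)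
    (j : ℕ) : ℝ :=
  cov[x 0, x ((j : ℝ≥0) * h); P]

/-! ### ARMA processes -/

/-- A sequence of i.i.d. random variables with law `N(0, v)`. -/
structure IsGaussianNoise {Ω : Type*} [MeasurableSpace Ω] (v : ℝ≥0) (W : ℤ → Ω → ℝ)
    (P : Measure Ω) : Prop where
  indep : iIndepFun W P
  law : ∀ n, HasLaw (W n) (gaussianReal 0 v) P

/-- The autoregressive polynomial `1 - φ₁ z - ⋯ - φₚ zᵖ` (with `φ i` standing for `φ_{i+1}`). -/
def arPoly {p : ℕ} (φ : Fin p → ℝ) : Polynomial ℝ :=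
  1 - ∑ i : Fin p, Polynomial.C (φ i) * Polynomial.X ^ ((i : ℕ) + 1)

/-- The moving average polynomial `1 + θ₁ z + ⋯ + θ_q z^q` (with `θ j` standing for
`θ_{j+1}`). -/
def maPoly {q : ℕ} (θ : Fin q → ℝ) : Polynomial ℝ :=
  1 + ∑ j : Fin q, Polynomial.C (θ j) * Polynomial.X ^ ((j : ℕ) + 1)

/-- `X` is a (mean zero) ARMA(p, q) process with coefficients `φ`, `θ` and noise variance `v`:
it is stationary, it satisfies
`X_n - φ₁ X_{n-1} - ⋯ - φₚ X_{n-p} = W_n + θ₁ W_{n-1} + ⋯ + θ_q W_{n-q}`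
for some i.i.d. `N(0, v)` sequence `W`, and the two polynomials have no common factor. -/
structure IsARMA {Ω : Type*} [MeasurableSpace Ω] {p q : ℕ} (φ : Fin p → ℝ) (θ : Fin q → ℝ)
    (v : ℝ≥0) (X : ℤ → Ω → ℝ) (P : Measure Ω) : Prop where
  stationary : IsStrictlyStationary X P
  recursion : ∃ W : ℤ → Ω → ℝ, IsGaussianNoise v W P ∧
    ∀ n : ℤ, ∀ᵐ ω ∂P,
      X n ω - ∑ i : Fin p, φ i * X (n - ((i : ℤ) + 1)) ω
        = W n ω + ∑ j : Fin q, θ j * W (n - ((j : ℤ) + 1)) ω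
  coprime : IsCoprime (arPoly φ) (maPoly θ)

/-- Causality: the autoregressive polynomial has no zero in the closed unit disc. -/
def IsCausal {p : ℕ} (φ : Fin p → ℝ) : Prop :=
  ∀ z : ℂ, ‖z‖ ≤ 1 → Polynomial.aeval z (arPoly φ) ≠ 0

/-- Invertibility: the moving average polynomial has no zero in the closed unit disc. -/
def IsInvertibleMA {q : ℕ} (θ : Fin q → ℝ) : Prop :=
  ∀ z : ℂ, ‖z‖ ≤ 1 → Polynomial.aeval z (maPoly θ) ≠ 0

/-- The sequence `(X_n)_{n ≥ 0}` has the same law as the sampled process `(x_{n h})_{n ≥ 0}`. -/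
def SameLawAsSamples {Ω Ω' : Type*} [MeasurableSpace Ω] [MeasurableSpace Ω']
    (X : ℤ → Ω' → ℝ) (P' : Measure Ω') (x : ℝ≥0 → Ω → ℝ) (h : ℝ≥0) (P : Measure Ω) : Prop :=
  IdentDistrib (fun ω' (n : ℕ) => X (n : ℤ) ω') (fun ω (n : ℕ) => x ((n : ℝ≥0) * h) ω) P' P

end

/-!
# The sampled Langevin process as an ARMA(2,1) process

**Gaussianity.** Variation of constants writes `u x_t + w y_t` as a row of `exp (t A)` applied to
the initial condition, plus a linear functional of the Brownian path (`langevin_path`; as the noise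
is additive, no stochastic integral is needed). The initial condition is forgotten as `t → ∞`. By
stationarity, `(x, y)` has the law of its time shifts, so its linear combinations have the law of a
limit of Gaussian variables and are centred Gaussian (`exists_hasLaw_gaussianReal_of_tendsto`). The
same argument applies to stationary solutions of a causal ARMA(2,1) recursion. Hence both laws are
determined by covariances (`IsCenteredGaussianProcess.identDistrib`).

**Autocovariances.** Differentiating the conservation of the variance of `u x_t + w y_t` at `t = 0`
gives the Lyapunov equation for the stationary covariance matrix, so that the covariance of `x_0`
and `x_t` is `σ² / (2 α γ)` times `(exp (t A))₁₁`. Solving the differential equation of this entry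
gives the closed forms, and the Cayley-Hamilton theorem for `exp (h A)` gives the recursion with
the coefficients `a₁` and `a₂`.

**The ARMA parameters.** The energy `a² / α + b²` is strictly decreasing along the rows of
`exp (t A)`. Therefore `exp (h A)` has spectral radius less than one (`langevin_causal`) and the
function `r + 2 s cos x`, with `r = v (1 + θ₁²)` and `s = v θ₁` to be achieved, is positive
(`langevin_two_mul_abs_lt`), which makes `θ₁` and `v` solvable with `|θ₁| < 1`. The two polynomials
are coprime, since the autocovariances are not a geometric sequence. The two equations for `θ₁` and
`v` are the Yule-Walker equations of the ARMA(2,1) model, so its autocovariances are those of the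
samples (`IsARMASolution.covariance_eq`). A solution is the causal moving average of a noise
(`isARMASolution_armaSeries`).

**Uniqueness.** If two causal invertible ARMA processes `(φ, θ, w)` and `(φ', θ', v)` have the same
autocovariances, then so have the results of filtering both by `φ φ'`, which are moving averages
with the polynomials `φ' θ` and `φ θ'`. The autocovariances of a moving average with polynomial `f`
are the coefficients of `f(1/z) f(z)`, from which `f` can be recovered when it has no zero in the
closed unit disc (`eq_of_reflect_mul_eq`). So `φ' θ = φ θ'` and `w = v`, and coprimality gives
`φ = φ'` and `θ = θ'` (`IsARMA.eq_of_covariance_eq`).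
-/


open Filter Topology

/-! ### Centred Gaussian variables and processes -/

section Gaussian

variable {Ω Ω' T : Type*} [MeasurableSpace Ω] [MeasurableSpace Ω'] {P : Measure Ω}
  {P' : Measure Ω'}

/-- If the characteristic functions of `N(0, vₙ)` converge pointwise to that of a probability
measure `μ`, then the variances converge and `μ` is the corresponding Gaussian law. The variances
cannot escape to infinity because `charFun μ` is continuous at `0`. -/
theorem exists_eq_gaussianReal_of_tendsto_charFun {μ : Measure ℝ} [IsProbabilityMeasure μ]
    {v : ℕ → ℝ≥0}
    (h : ∀ t, Tendsto (fun n => charFun (gaussianReal 0 (v n)) t) atTop (𝓝 (charFun μ t))) :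
    ∃ w, μ = gaussianReal 0 w ∧ Tendsto v atTop (𝓝 w) := by
  have hform : ∀ (a : ℝ≥0) (t : ℝ),
      charFun (gaussianReal 0 a) t = ((Real.exp (-(a * t ^ 2 / 2)) : ℝ) : ℂ) := by
    intro a t
    rw [charFun_gaussianReal]; push_cast; congr 1; ring
  have hre : ∀ t, Tendsto (fun n => Real.exp (-(v n * t ^ 2 / 2))) atTop
      (𝓝 (charFun μ t).re) := by
    intro t
    have := (Complex.continuous_re.tendsto _).comp (h t)
    simpa [Function.comp_def, hform, -Complex.ofReal_exp] using this
  have hcont : Continuous fun t => (charFun μ t).re :=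
    Complex.continuous_re.comp continuous_charFun
  -- The real part of the limit at `t` is the `t ^ 2`-th power of its value at `1`.
  have hpos : 0 < (charFun μ 1).re := by
    by_contra hneg
    have h1 : (charFun μ 1).re = 0 :=
      le_antisymm (not_lt.1 hneg) (ge_of_tendsto' (hre 1) fun n => (Real.exp_pos _).le)
    have hz : ∀ t : ℝ, t ≠ 0 → (charFun μ t).re = 0 := by
      intro t ht
      have h2 : Tendsto (fun n => (Real.exp (-(v n * (1 : ℝ) ^ 2 / 2))) ^ (t ^ 2)) atTop
          (𝓝 ((0 : ℝ) ^ (t ^ 2))) := by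
        have := hre 1
        rw [h1] at this
        exact this.rpow_const (Or.inr (by positivity))
      rw [Real.zero_rpow (by positivity)] at h2
      refine tendsto_nhds_unique (hre t) (h2.congr fun n => ?_)
      rw [← Real.exp_mul]; congr 1; ring
    have h3 : Tendsto (fun t => (charFun μ t).re) (𝓝[≠] 0) (𝓝 ((charFun μ 0).re)) :=
      (hcont.tendsto 0).mono_left nhdsWithin_le_nhds
    have h4 : Tendsto (fun t => (charFun μ t).re) (𝓝[≠] 0) (𝓝 0) :=
      tendsto_const_nhds.congr' (by
        filter_upwards [self_mem_nhdsWithin] with t ht using (hz t ht).symm)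
    have := tendsto_nhds_unique h3 h4
    simp at this
  have hv : Tendsto (fun n => (v n : ℝ)) atTop (𝓝 (-2 * Real.log (charFun μ 1).re)) := by
    have := ((Real.continuousAt_log hpos.ne').tendsto.comp (hre 1)).const_mul (-2)
    refine this.congr fun n => ?_
    simp only [Function.comp, Real.log_exp]; ring
  have hw0 : 0 ≤ -2 * Real.log (charFun μ 1).re := ge_of_tendsto' hv fun n => (v n).2
  obtain ⟨w, hw⟩ : ∃ w : ℝ≥0, (w : ℝ) = -2 * Real.log (charFun μ 1).re := ⟨⟨_, hw0⟩, rfl⟩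
  rw [← hw] at hv
  refine ⟨w, Measure.ext_of_charFun ?_, NNReal.tendsto_coe.1 hv⟩
  ext t
  refine tendsto_nhds_unique (h t) ?_
  simp_rw [hform]
  refine (Complex.continuous_ofReal.tendsto _).comp ?_
  refine (Real.continuous_exp.tendsto _).comp ?_
  exact ((hv.mul_const (t ^ 2)).div_const 2).neg

/-- A variable `Z` which for every `n` has the law of some `Lₙ`, where `Lₙ` is almost surely
asymptotic to a centred Gaussian variable `Yₙ`, is itself centred Gaussian. The variables `Lₙ`
are allowed to vary, which is what makes the statement applicable to the shifts of a stationary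
process. -/
theorem exists_hasLaw_gaussianReal_of_tendsto [IsProbabilityMeasure P] {L Y : ℕ → Ω → ℝ}
    {Z : Ω → ℝ} {v : ℕ → ℝ≥0} (hL : ∀ n, IdentDistrib (L n) Z P P)
    (hY : ∀ n, HasLaw (Y n) (gaussianReal 0 (v n)) P)
    (h : ∀ᵐ ω ∂P, Tendsto (fun n => L n ω - Y n ω) atTop (𝓝 0)) :
    ∃ w, HasLaw Z (gaussianReal 0 w) P ∧ Tendsto v atTop (𝓝 w) := by
  have hZ : AEMeasurable Z P := (hL 0).aemeasurable_snd
  have h1 : TendstoInDistribution L atTop Z (fun _ => P) P :=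
    tendstoInDistribution_of_identDistrib 0 (fun j => (hL 0).trans (hL j).symm) (hL 0)
  have hmeas : ∀ n, AEStronglyMeasurable ((Y - L) n) P := fun n =>
    ((hY n).aemeasurable.sub (hL n).aemeasurable_fst).aestronglyMeasurable
  have h2 : TendstoInMeasure P (Y - L) atTop 0 := by
    refine tendstoInMeasure_of_tendsto_ae hmeas ?_
    filter_upwards [h] with ω hω
    simpa using hω.neg
  have h3 := tendstoInDistribution_of_tendstoInMeasure_sub Y Z h1 h2
    fun n => (hY n).aemeasurable
  have h4 := ProbabilityMeasure.tendsto_iff_tendsto_charFun.1 h3.tendsto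
  have : IsProbabilityMeasure (P.map Z) := Measure.isProbabilityMeasure_map hZ
  obtain ⟨w, hw, hvw⟩ := exists_eq_gaussianReal_of_tendsto_charFun (μ := P.map Z) (v := v)
    (fun t => by simpa [(hY _).map_eq] using h4 t)
  exact ⟨w, ⟨hZ, hw⟩, hvw⟩

/-- A real random variable with law `N(0, v)` for some `v ≥ 0`. -/
def IsCenteredGaussian (X : Ω → ℝ) (P : Measure Ω) : Prop :=
  ∃ v : ℝ≥0, HasLaw X (gaussianReal 0 v) P

namespace IsCenteredGaussian

variable {X Y : Ω → ℝ}

theorem hasGaussianLaw (hX : IsCenteredGaussian X P) : HasGaussianLaw X P := by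
  obtain ⟨v, hv⟩ := hX
  exact ⟨by rw [hv.map_eq]; infer_instance⟩

theorem memLp_two (hX : IsCenteredGaussian X P) : MemLp X 2 P := hX.hasGaussianLaw.memLp_two

theorem integral_eq_zero (hX : IsCenteredGaussian X P) : ∫ ω, X ω ∂P = 0 := by
  obtain ⟨v, hv⟩ := hX
  rw [hv.integral_eq]; simp

theorem hasLaw (hX : IsCenteredGaussian X P) :
    HasLaw X (gaussianReal 0 (Var[X; P]).toNNReal) P := by
  obtain ⟨v, hv⟩ := hX
  have : Var[X; P] = v := by rw [hv.variance_eq]; simp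
  rw [this]; simpa using hv

end IsCenteredGaussian

theorem HasGaussianLaw.isCenteredGaussian {X : Ω → ℝ} (hX : HasGaussianLaw X P)
    (h0 : ∫ ω, X ω ∂P = 0) : IsCenteredGaussian X P := by
  have h := hX.isGaussian_map.eq_gaussianReal
  rw [integral_map hX.aemeasurable (by fun_prop)] at h
  simp only [id, h0] at h
  exact ⟨_, hX.aemeasurable, h⟩

/-- A process all of whose finite linear combinations are centred Gaussian variables. -/
def IsCenteredGaussianProcess (X : T → Ω → ℝ) (P : Measure Ω) : Prop :=
  ∀ S : T →₀ ℝ, IsCenteredGaussian (fun ω => Finsupp.linearCombination ℝ (fun t => X t ω) S) P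

theorem integral_linearCombination {X : T → Ω → ℝ} (hX : ∀ t, Integrable (X t) P)
    (S : T →₀ ℝ) :
    ∫ ω, Finsupp.linearCombination ℝ (fun t => X t ω) S ∂P
      = S.sum fun t a => a * ∫ ω, X t ω ∂P := by
  simp only [Finsupp.linearCombination_apply, Finsupp.sum, smul_eq_mul]
  rw [integral_finsetSum _ fun t _ => (hX t).const_mul _]
  simp_rw [integral_const_mul]

theorem covariance_linearCombination [IsFiniteMeasure P] {X : T → Ω → ℝ}
    (hX : ∀ t, MemLp (X t) 2 P) (S R : T →₀ ℝ) :
    cov[fun ω => Finsupp.linearCombination ℝ (fun t => X t ω) S,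
      fun ω => Finsupp.linearCombination ℝ (fun t => X t ω) R; P]
      = S.sum fun s a => R.sum fun t b => a * (b * cov[X s, X t; P]) := by
  simp only [Finsupp.linearCombination_apply, Finsupp.sum, smul_eq_mul]
  rw [covariance_fun_sum_fun_sum' (fun t _ => (hX t).const_mul _) (fun t _ => (hX t).const_mul _)]
  simp_rw [covariance_const_mul_left, covariance_const_mul_right]

theorem ProbabilityTheory.IsGaussianProcess.isCenteredGaussianProcess {X : T → Ω → ℝ}
    (hX : IsGaussianProcess X P) (h0 : ∀ t, ∫ ω, X t ω ∂P = 0) :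
    IsCenteredGaussianProcess X P := by
  intro S
  refine HasGaussianLaw.isCenteredGaussian ?_ ?_
  · have h1 : IsGaussianProcess (fun t ω => S t • X t ω) P := hX.smul S
    have h2 := h1.hasGaussianLaw_fun_sum (I := S.support)
    simpa only [Finsupp.linearCombination_apply, Finsupp.sum] using h2
  · rw [integral_linearCombination fun t => (hX.hasGaussianLaw_eval t).integrable]
    simp [h0]

namespace IsCenteredGaussianProcess

variable {X : T → Ω → ℝ}

theorem eval (hX : IsCenteredGaussianProcess X P) (t : T) : IsCenteredGaussian (X t) P := by
  have := hX (Finsupp.single t 1)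
  simpa using this

theorem aemeasurable (hX : IsCenteredGaussianProcess X P) (t : T) : AEMeasurable (X t) P :=
  (hX.eval t).hasGaussianLaw.aemeasurable

theorem comp (hX : IsCenteredGaussianProcess X P) {T' : Type*} (f : T' → T) :
    IsCenteredGaussianProcess (fun t => X (f t)) P := by
  intro S
  have := hX (S.mapDomain f)
  simp only [Finsupp.linearCombination_mapDomain] at this
  exact this

/-- Centred Gaussian processes indexed by a countable set with the same covariances have the same
law. -/
theorem identDistrib [IsProbabilityMeasure P] [IsProbabilityMeasure P'] [Countable T]
    {Y : T → Ω' → ℝ}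
    (hX : IsCenteredGaussianProcess X P) (hY : IsCenteredGaussianProcess Y P')
    (hcov : ∀ s t, cov[X s, X t; P] = cov[Y s, Y t; P']) :
    IdentDistrib (fun ω t => X t ω) (fun ω t => Y t ω) P P' := by
  have hXm := aemeasurable_pi_lambda (fun ω t => X t ω) fun t => hX.aemeasurable t
  have hYm := aemeasurable_pi_lambda (fun ω t => Y t ω) fun t => hY.aemeasurable t
  refine ⟨hXm, hYm, ?_⟩
  have : IsProbabilityMeasure (P'.map fun ω t => Y t ω) := Measure.isProbabilityMeasure_map hYm
  refine IsProjectiveLimit.unique (isProjectiveLimit_map hXm) (fun I => ?_)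
  rw [isProjectiveLimit_map hYm I]
  symm
  have hXI : AEMeasurable (fun ω => I.restrict (X · ω)) P :=
    aemeasurable_pi_lambda _ fun t => hX.aemeasurable t
  have hYI : AEMeasurable (fun ω => I.restrict (Y · ω)) P' :=
    aemeasurable_pi_lambda _ fun t => hY.aemeasurable t
  have : IsProbabilityMeasure (P.map fun ω => I.restrict (X · ω)) :=
    Measure.isProbabilityMeasure_map hXI
  have : IsProbabilityMeasure (P'.map fun ω => I.restrict (Y · ω)) :=
    Measure.isProbabilityMeasure_map hYI
  classical
  refine Measure.ext_of_charFunDual ?_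
  ext L
  rw [charFunDual_eq_charFun_map_one, charFunDual_eq_charFun_map_one,
    AEMeasurable.map_map_of_aemeasurable (by fun_prop) hXI,
    AEMeasurable.map_map_of_aemeasurable (by fun_prop) hYI]
  let S : T →₀ ℝ := ∑ i : I, Finsupp.single (i : T) (L (Pi.single i 1))
  have hL : ∀ f : T → ℝ, L (I.restrict f) = Finsupp.linearCombination ℝ f S := by
    intro f
    simp only [S, map_sum, Finsupp.linearCombination_single, smul_eq_mul]
    have hf : I.restrict f = ∑ i : I, f i • (Pi.single i 1 : I → ℝ) :=
      pi_eq_sum_univ' (I.restrict f)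
    rw [hf, map_sum]
    exact Finset.sum_congr rfl fun i _ => by rw [map_smul, smul_eq_mul, mul_comm]
  -- Both laws are determined by the variances of the combinations `S`, hence by the covariances.
  have e1 : (L ∘ fun ω => I.restrict (X · ω))
      = fun ω => Finsupp.linearCombination ℝ (fun t => X t ω) S := by ext ω; exact hL _
  have e2 : (L ∘ fun ω => I.restrict (Y · ω))
      = fun ω => Finsupp.linearCombination ℝ (fun t => Y t ω) S := by ext ω; exact hL _
  rw [e1, e2, (hX S).hasLaw.map_eq, (hY S).hasLaw.map_eq]
  congr 3
  rw [← covariance_self (hX S).hasGaussianLaw.aemeasurable,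
    ← covariance_self (hY S).hasGaussianLaw.aemeasurable,
    covariance_linearCombination (fun t => (hX.eval t).memLp_two),
    covariance_linearCombination (fun t => (hY.eval t).memLp_two)]
  simp_rw [hcov]

end IsCenteredGaussianProcess

/-- A form of the Cauchy-Schwarz inequality. -/
theorem abs_covariance_le [IsFiniteMeasure P] {X Y : Ω → ℝ} (hX : MemLp X 2 P)
    (hY : MemLp Y 2 P) : |cov[X, Y; P]| ≤ (Var[X; P] + Var[Y; P]) / 2 := by
  have h1 := variance_nonneg (X + Y) P
  have h2 := variance_nonneg (X - Y) P
  rw [variance_add hX hY] at h1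
  rw [variance_sub hX hY] at h2
  rw [abs_le]; constructor <;> linarith

/-- A random variable that is almost surely a limit of finite linear combinations of the values of
the process `X`. -/
def IsLinearLimit (X : T → Ω → ℝ) (Z : Ω → ℝ) (P : Measure Ω) : Prop :=
  ∃ S : ℕ → T →₀ ℝ, ∀ᵐ ω ∂P,
    Tendsto (fun N => Finsupp.linearCombination ℝ (fun t => X t ω) (S N)) atTop (𝓝 (Z ω))

namespace IsLinearLimit

variable {X : T → Ω → ℝ} {Z Z' : Ω → ℝ}

theorem eval (X : T → Ω → ℝ) (P : Measure Ω) (t : T) : IsLinearLimit X (X t) P :=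
  ⟨fun _ => Finsupp.single t 1, by simp⟩

theorem add (h : IsLinearLimit X Z P) (h' : IsLinearLimit X Z' P) :
    IsLinearLimit X (fun ω => Z ω + Z' ω) P := by
  obtain ⟨S, hS⟩ := h
  obtain ⟨S', hS'⟩ := h'
  refine ⟨S + S', ?_⟩
  filter_upwards [hS, hS'] with ω h1 h2
  simpa using h1.add h2

theorem const_mul (h : IsLinearLimit X Z P) (a : ℝ) : IsLinearLimit X (fun ω => a * Z ω) P := by
  obtain ⟨S, hS⟩ := h
  refine ⟨a • S, ?_⟩
  filter_upwards [hS] with ω h1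
  simpa using h1.const_mul a

theorem zero (X : T → Ω → ℝ) (P : Measure Ω) : IsLinearLimit X (fun _ => 0) P :=
  ⟨fun _ => 0, by simp⟩

theorem sum {ι : Type*} (s : Finset ι) {Z : ι → Ω → ℝ} (h : ∀ i ∈ s, IsLinearLimit X (Z i) P) :
    IsLinearLimit X (fun ω => ∑ i ∈ s, Z i ω) P := by
  classical
  induction s using Finset.induction_on with
  | empty => simpa using zero X P
  | insert i s his ih =>
    simp_rw [Finset.sum_insert his]
    exact (h i (by simp)).add (ih fun j hj => h j (by simp [hj]))

/-- A limit of centred Gaussian variables is centred Gaussian, and its variance is the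
limit of the variances. -/
theorem exists_tendsto_variance [IsProbabilityMeasure P] (hX : IsCenteredGaussianProcess X P)
    {S : ℕ → T →₀ ℝ} (hZ : AEMeasurable Z P) (h : ∀ᵐ ω ∂P,
      Tendsto (fun N => Finsupp.linearCombination ℝ (fun t => X t ω) (S N)) atTop (𝓝 (Z ω))) :
    IsCenteredGaussian Z P ∧ Tendsto (fun N =>
      Var[fun ω => Finsupp.linearCombination ℝ (fun t => X t ω) (S N); P]) atTop
      (𝓝 Var[Z; P]) := by
  obtain ⟨w, hw, hlim⟩ := exists_hasLaw_gaussianReal_of_tendsto (L := fun _ => Z)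
    (fun _ => IdentDistrib.refl hZ) (fun N => (hX (S N)).hasLaw) (by
      filter_upwards [h] with ω hω
      simpa using (tendsto_const_nhds (x := Z ω)).sub hω)
  refine ⟨⟨w, hw⟩, ?_⟩
  have : Var[Z; P] = w := by rw [hw.variance_eq]; simp
  rw [this]
  refine (NNReal.tendsto_coe.2 hlim).congr fun N => ?_
  exact Real.coe_toNNReal _ (variance_nonneg _ _)

theorem aemeasurable (hX : ∀ t, AEMeasurable (X t) P) (h : IsLinearLimit X Z P) :
    AEMeasurable Z P := by
  obtain ⟨S, hS⟩ := h
  refine aemeasurable_of_tendsto_metrizable_ae atTop (fun N => ?_) hS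
  simp only [Finsupp.linearCombination_apply, Finsupp.sum, smul_eq_mul]
  exact Finset.aemeasurable_fun_sum _ fun t _ => (hX t).const_mul _

theorem isCenteredGaussian [IsProbabilityMeasure P] (hX : IsCenteredGaussianProcess X P)
    (h : IsLinearLimit X Z P) : IsCenteredGaussian Z P := by
  obtain ⟨S, hS⟩ := id h
  exact (exists_tendsto_variance hX (h.aemeasurable hX.aemeasurable) hS).1

/-- A linear limit of `X` is almost surely a measurable function of the whole path of `X`, hence
independent of everything `X` is independent of. -/
theorem indepFun {E : Type*} [MeasurableSpace E] {V : Ω → E} (h : IsLinearLimit X Z P)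
    (hV : IndepFun V (fun ω t => X t ω) P) : IndepFun V Z P := by
  obtain ⟨S, hS⟩ := h
  -- The limit is taken in the extended reals, where the upper limit is measurable without any
  -- boundedness assumption.
  let F : (T → ℝ) → ℝ := fun b =>
    (limsup (fun N => ((Finsupp.linearCombination ℝ b (S N) : ℝ) : EReal)) atTop).toReal
  have hF : Measurable F := by
    refine measurable_ereal_toReal.comp (Measurable.limsup fun N => ?_)
    refine measurable_coe_real_ereal.comp ?_
    simp only [Finsupp.linearCombination_apply, Finsupp.sum, smul_eq_mul]
    fun_prop
  refine (hV.comp measurable_id hF).congr (ae_eq_refl _) ?_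
  filter_upwards [hS] with ω hω
  have : Tendsto (fun N => ((Finsupp.linearCombination ℝ (fun t => X t ω) (S N) : ℝ) : EReal))
      atTop (𝓝 ((Z ω : ℝ) : EReal)) := (continuous_coe_real_ereal.tendsto _).comp hω
  simp only [Function.comp, F]
  rw [this.limsup_eq, EReal.toReal_coe]

end IsLinearLimit

end Gaussian

/-! ### The flow of the Langevin drift -/

section Flow

variable {γ α : ℝ}

/-- The entry `(exp (t A))₁₁` as a function of time. -/
noncomputable def flowP (γ α t : ℝ) : ℝ := langevinPropagator γ α t 0 0

/-- The entry `(exp (t A))₁₂` as a function of time. -/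
noncomputable def flowQ (γ α t : ℝ) : ℝ := langevinPropagator γ α t 0 1

theorem langevinMatrix_mul_langevinPropagator (γ α t : ℝ) :
    langevinMatrix γ α * langevinPropagator γ α t
      = langevinPropagator γ α t * langevinMatrix γ α :=
  (((Commute.refl (langevinMatrix γ α)).smul_right t).exp_right).eq

theorem langevinPropagator_zero (γ α : ℝ) : langevinPropagator γ α 0 = 1 := by
  simp [langevinPropagator, NormedSpace.exp_zero]

theorem langevinPropagator_add (γ α s t : ℝ) :
    langevinPropagator γ α (s + t) = langevinPropagator γ α s * langevinPropagator γ α t := by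
  rw [langevinPropagator, add_smul]
  exact Matrix.exp_add_of_commute _ _ (((Commute.refl _).smul_right t).smul_left s)

/-- The exponential is a polynomial in `A`; this is the resulting shape of its second row. -/
theorem langevinPropagator_eq (γ α t : ℝ) : langevinPropagator γ α t
    = !![flowP γ α t, flowQ γ α t; -α * flowQ γ α t, flowP γ α t - γ * flowQ γ α t] := by
  have h := langevinMatrix_mul_langevinPropagator γ α t
  have h1 := congrFun (congrFun h 0) 0
  have h2 := congrFun (congrFun h 0) 1
  simp only [langevinMatrix, Matrix.mul_apply, Fin.sum_univ_two, Matrix.of_apply,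
    Matrix.cons_val_zero, Matrix.cons_val_one, Matrix.cons_val_fin_one, Matrix.cons_val'] at h1 h2
  ext i j
  fin_cases i <;> fin_cases j <;> simp [flowP, flowQ] <;> linarith

theorem hasDerivAt_langevinPropagator (γ α t : ℝ) (i j : Fin 2) :
    HasDerivAt (fun t => langevinPropagator γ α t i j)
      ((langevinPropagator γ α t * langevinMatrix γ α) i j) t := by
  let _ : NormedRing (Matrix (Fin 2) (Fin 2) ℝ) := Matrix.linftyOpNormedRing
  let _ : NormedAlgebra ℝ (Matrix (Fin 2) (Fin 2) ℝ) := Matrix.linftyOpNormedAlgebra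
  have h := hasDerivAt_exp_smul_const (𝕂 := ℝ) (langevinMatrix γ α) t
  exact hasDerivAt_pi.1 (hasDerivAt_pi.1 h i) j

theorem hasDerivAt_flowP (γ α t : ℝ) : HasDerivAt (flowP γ α) (-α * flowQ γ α t) t := by
  have h := hasDerivAt_langevinPropagator γ α t 0 0
  rw [langevinPropagator_eq] at h
  refine h.congr_deriv ?_
  simp [langevinMatrix, Matrix.mul_apply, mul_comm]

theorem hasDerivAt_flowQ (γ α t : ℝ) :
    HasDerivAt (flowQ γ α) (flowP γ α t - γ * flowQ γ α t) t := by
  have h := hasDerivAt_langevinPropagator γ α t 0 1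
  rw [langevinPropagator_eq] at h
  refine h.congr_deriv ?_
  simp [langevinMatrix, Matrix.mul_apply]; ring

@[simp] theorem flowP_zero : flowP γ α 0 = 1 := by simp [flowP, langevinPropagator_zero]

@[simp] theorem flowQ_zero : flowQ γ α 0 = 0 := by simp [flowQ, langevinPropagator_zero]

theorem flowP_add (s t : ℝ) :
    flowP γ α (s + t) = flowP γ α s * flowP γ α t - α * flowQ γ α s * flowQ γ α t := by
  conv_lhs => rw [flowP, langevinPropagator_add, langevinPropagator_eq, langevinPropagator_eq]
  simp [Matrix.mul_apply]; ring

theorem flowQ_add (s t : ℝ) : flowQ γ α (s + t)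
    = flowP γ α s * flowQ γ α t + flowQ γ α s * (flowP γ α t - γ * flowQ γ α t) := by
  conv_lhs => rw [flowQ, langevinPropagator_add, langevinPropagator_eq, langevinPropagator_eq]
  simp [Matrix.mul_apply]

theorem trace_langevinPropagator (t : ℝ) :
    (langevinPropagator γ α t).trace = 2 * flowP γ α t - γ * flowQ γ α t := by
  rw [langevinPropagator_eq]; simp [Matrix.trace_fin_two]; ring

/-- The determinant of `exp (t A)` is `exp (-γ t)`, by Liouville's formula. -/
theorem flow_det (t : ℝ) :
    flowP γ α t * (flowP γ α t - γ * flowQ γ α t) + α * flowQ γ α t ^ 2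
      = Real.exp (-γ * t) := by
  let f : ℝ → ℝ := fun t =>
    (flowP γ α t * (flowP γ α t - γ * flowQ γ α t) + α * flowQ γ α t ^ 2) * Real.exp (γ * t)
  have hf : ∀ t, HasDerivAt f 0 t := by
    intro t
    have hp := hasDerivAt_flowP γ α t
    have hq := hasDerivAt_flowQ γ α t
    have he : HasDerivAt (fun t => Real.exp (γ * t)) (Real.exp (γ * t) * γ) t := by
      simpa using ((hasDerivAt_id t).const_mul γ).exp
    have := ((hp.mul (hp.sub (hq.const_mul γ))).add ((hq.pow 2).const_mul α)).mul he
    refine this.congr_deriv ?_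
    simp; ring
  have hconst := is_const_of_deriv_eq_zero (fun t => (hf t).differentiableAt)
    (fun t => (hf t).deriv) t 0
  simp only [f, flowP_zero, flowQ_zero] at hconst
  have : Real.exp (-γ * t) * Real.exp (γ * t) = 1 := by rw [← Real.exp_add]; simp
  have hne := (Real.exp_pos (γ * t)).ne'
  apply mul_right_cancel₀ hne
  rw [hconst, this]; simp

/-- The row vectors `(1, l)`, with `l` an eigenvalue of `A`, are left eigenvectors of `A`. -/
theorem flowP_add_mul_flowQ {l : ℂ} (hl : l ^ 2 + γ * l + α = 0) (t : ℝ) :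
    (flowP γ α t : ℂ) + l * flowQ γ α t = Complex.exp (l * t) := by
  let f : ℝ → ℂ := fun t => ((flowP γ α t : ℂ) + l * flowQ γ α t) * Complex.exp (-l * t)
  have hf : ∀ t, HasDerivAt f 0 t := by
    intro t
    have hp := (hasDerivAt_flowP γ α t).ofReal_comp
    have hq := (hasDerivAt_flowQ γ α t).ofReal_comp
    have he : HasDerivAt (fun t : ℝ => Complex.exp (-l * t)) (Complex.exp (-l * t) * -l) t := by
      simpa using ((Complex.ofRealCLM.hasDerivAt (x := t)).const_mul (-l)).cexp
    have := (hp.add (hq.const_mul l)).mul he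
    refine this.congr_deriv ?_
    push_cast
    simp only [Pi.add_apply]
    linear_combination -(flowQ γ α t * Complex.exp (-l * t)) * hl
  have hconst := is_const_of_deriv_eq_zero (fun t => (hf t).differentiableAt)
    (fun t => (hf t).deriv) t 0
  simp only [f, flowP_zero, flowQ_zero] at hconst
  have : Complex.exp (l * t) * Complex.exp (-l * t) = 1 := by rw [← Complex.exp_add]; simp
  apply mul_right_cancel₀ (Complex.exp_ne_zero (-l * t))
  rw [hconst, this]; simp

theorem flowP_eq_of_ne {l₁ l₂ : ℂ} (hne : l₁ ≠ l₂) (h₁ : l₁ ^ 2 + γ * l₁ + α = 0)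
    (h₂ : l₂ ^ 2 + γ * l₂ + α = 0) (t : ℝ) :
    (flowP γ α t : ℂ) = (l₁ * Complex.exp (l₂ * t) - l₂ * Complex.exp (l₁ * t)) / (l₁ - l₂) := by
  rw [eq_div_iff (sub_ne_zero.2 hne), ← flowP_add_mul_flowQ h₁, ← flowP_add_mul_flowQ h₂]
  ring

theorem flowP_eq_of_discrim_eq_zero (h : γ ^ 2 - 4 * α = 0) (t : ℝ) :
    flowP γ α t = Real.exp (-γ / 2 * t) * (1 - -γ / 2 * t) := by
  have hlin : ∀ t, flowP γ α t - γ / 2 * flowQ γ α t = Real.exp (-γ / 2 * t) := by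
    intro t
    have hl : ((-γ / 2 : ℝ) : ℂ) ^ 2 + γ * ((-γ / 2 : ℝ) : ℂ) + α = 0 := by
      have : (-γ / 2 : ℝ) ^ 2 + γ * (-γ / 2) + α = 0 := by linarith
      exact_mod_cast this
    have := flowP_add_mul_flowQ hl t
    have h2 : flowP γ α t + (-γ / 2) * flowQ γ α t = Real.exp (-γ / 2 * t) := by exact_mod_cast this
    linarith
  let f : ℝ → ℝ := fun t => flowQ γ α t * Real.exp (γ / 2 * t) - t
  have hf : ∀ t, HasDerivAt f 0 t := by
    intro t
    have hq := hasDerivAt_flowQ γ α t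
    have he : HasDerivAt (fun t => Real.exp (γ / 2 * t)) (Real.exp (γ / 2 * t) * (γ / 2)) t := by
      simpa using ((hasDerivAt_id t).const_mul (γ / 2)).exp
    have := (hq.mul he).sub (hasDerivAt_id t)
    refine this.congr_deriv ?_
    have h1 : Real.exp (-γ / 2 * t) * Real.exp (γ / 2 * t) = 1 := by
      rw [← Real.exp_add]; simp; ring
    rw [← hlin] at h1
    linarith
  have hconst := is_const_of_deriv_eq_zero (fun t => (hf t).differentiableAt)
    (fun t => (hf t).deriv) t 0
  simp only [f, flowQ_zero] at hconst
  have h1 : Real.exp (-γ / 2 * t) * Real.exp (γ / 2 * t) = 1 := by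
    rw [← Real.exp_add]; simp; ring
  have hq : flowQ γ α t = t * Real.exp (-γ / 2 * t) := by
    apply mul_right_cancel₀ (Real.exp_pos (γ / 2 * t)).ne'
    rw [mul_assoc, h1]; linarith
  have := hlin t
  rw [hq] at this
  linarith

/-- A trajectory `t ↦ (a t, b t)` of the row-vector equation `r' = r A`. These are the rows
`(u, w) exp (t A)`. -/
structure IsRowFlow (γ α : ℝ) (a b : ℝ → ℝ) : Prop where
  hasDerivAt_fst : ∀ t, HasDerivAt a (-α * b t) t
  hasDerivAt_snd : ∀ t, HasDerivAt b (a t - γ * b t) t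

/-- First component of `(u, w) exp (t A)`. -/
noncomputable def rowA (γ α u w t : ℝ) : ℝ := u * flowP γ α t + w * (-α * flowQ γ α t)

/-- Second component of `(u, w) exp (t A)`. -/
noncomputable def rowB (γ α u w t : ℝ) : ℝ :=
  u * flowQ γ α t + w * (flowP γ α t - γ * flowQ γ α t)

@[simp] theorem rowA_zero (u w : ℝ) : rowA γ α u w 0 = u := by simp [rowA]

@[simp] theorem rowB_zero (u w : ℝ) : rowB γ α u w 0 = w := by simp [rowB]

theorem isRowFlow_row (γ α u w : ℝ) : IsRowFlow γ α (rowA γ α u w) (rowB γ α u w) := by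
  constructor <;> intro t
  · have := ((hasDerivAt_flowP γ α t).const_mul u).add
      (((hasDerivAt_flowQ γ α t).const_mul (-α)).const_mul w)
    refine this.congr_deriv ?_
    simp only [rowB]; ring
  · have := ((hasDerivAt_flowQ γ α t).const_mul u).add
      (((hasDerivAt_flowP γ α t).sub ((hasDerivAt_flowQ γ α t).const_mul γ)).const_mul w)
    refine this.congr_deriv ?_
    simp only [rowA, rowB]; ring

/-- The energy `a² / α + b²` is strictly decreasing along nonzero trajectories: its derivative is
`-2 γ b²`, and `b` cannot vanish on an interval unless `a` does. -/
theorem IsRowFlow.energy_lt (hγ : 0 < γ) (hα : 0 < α) {a b : ℝ → ℝ} (hab : IsRowFlow γ α a b)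
    {h : ℝ} (hh : 0 < h) (hne : a 0 ≠ 0 ∨ b 0 ≠ 0) :
    a h ^ 2 / α + b h ^ 2 < a 0 ^ 2 / α + b 0 ^ 2 := by
  let E : ℝ → ℝ := fun t => a t ^ 2 / α + b t ^ 2
  have hE : ∀ t, HasDerivAt E (-2 * γ * b t ^ 2) t := by
    intro t
    have := (((hab.hasDerivAt_fst t).pow 2).div_const α).add ((hab.hasDerivAt_snd t).pow 2)
    refine this.congr_deriv ?_
    field_simp; simp; ring
  have hanti : Antitone E := antitone_of_hasDerivAt_nonpos hE fun t => by
    have := mul_nonneg hγ.le (sq_nonneg (b t))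
    show -2 * γ * b t ^ 2 ≤ 0
    linarith
  refine lt_of_le_of_ne (hanti hh.le) fun heq => ?_
  have hconst : ∀ t ∈ Set.Ioo 0 h, E t = E 0 := fun t ht =>
    le_antisymm (hanti ht.1.le) ((show E 0 = E h from heq.symm) ▸ hanti ht.2.le)
  have hloc : ∀ {f : ℝ → ℝ} {f' c : ℝ} {t : ℝ}, t ∈ Set.Ioo 0 h → (∀ s ∈ Set.Ioo 0 h, f s = c) →
      HasDerivAt f f' t → f' = 0 := by
    intro f f' c t ht hf hd
    refine hd.unique ((hasDerivAt_const t c).congr_of_eventuallyEq ?_)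
    filter_upwards [isOpen_Ioo.mem_nhds ht] with s hs using hf s hs
  have hb : ∀ t ∈ Set.Ioo 0 h, b t = 0 := by
    intro t ht
    have := hloc ht hconst (hE t)
    have hg : -2 * γ ≠ 0 := by linarith
    simpa [hg, hγ.ne'] using this
  have ha : ∀ t ∈ Set.Ioo 0 h, a t = 0 := by
    intro t ht
    have := hloc ht hb (hab.hasDerivAt_snd t)
    rwa [hb t ht, mul_zero, sub_zero] at this
  have hlim : ∀ {f f' : ℝ → ℝ}, (∀ t, HasDerivAt f (f' t) t) → (∀ t ∈ Set.Ioo 0 h, f t = 0) →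
      f 0 = 0 := by
    intro f f' hd hf
    have h1 : Tendsto f (𝓝[>] 0) (𝓝 (f 0)) := (hd 0).continuousAt.mono_left nhdsWithin_le_nhds
    refine tendsto_nhds_unique h1 (tendsto_const_nhds.congr' ?_)
    filter_upwards [Ioo_mem_nhdsGT hh] with t ht using (hf t ht).symm
  rcases hne with hne | hne
  · exact hne (hlim hab.hasDerivAt_fst ha)
  · exact hne (hlim hab.hasDerivAt_snd hb)

end Flow

/-! ### Second order linear recursions -/

section Recursion

variable {a₁ a₂ : ℝ}

/-- The impulse response of the recursion `sₙ₊₂ = a₁ sₙ₊₁ + a₂ sₙ`: the power series coefficients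
of `1 / (1 - a₁ z - a₂ z²)`. -/
def impulse (a₁ a₂ : ℝ) : ℕ → ℝ
  | 0 => 1
  | 1 => a₁
  | n + 2 => a₁ * impulse a₁ a₂ (n + 1) + a₂ * impulse a₁ a₂ n

theorem impulse_add_two (n : ℕ) :
    impulse a₁ a₂ (n + 2) = a₁ * impulse a₁ a₂ (n + 1) + a₂ * impulse a₁ a₂ n := rfl

/-- Causality makes the impulse response absolutely summable: it is the convolution of two
geometric sequences whose ratios are the inverses of the zeros of `1 - a₁ z - a₂ z²`. -/
theorem summable_abs_impulse
    (hroot : ∀ z : ℂ, ‖z‖ ≤ 1 → 1 - a₁ * z - a₂ * z ^ 2 ≠ 0) :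
    Summable fun n => |impulse a₁ a₂ n| := by
  obtain ⟨s, hs⟩ := IsAlgClosed.exists_pow_nat_eq ((a₁ : ℂ) ^ 2 + 4 * a₂) (n := 2) (by norm_num)
  obtain ⟨m₁, m₂, hsum, hprod⟩ : ∃ m₁ m₂ : ℂ, m₁ + m₂ = a₁ ∧ m₁ * m₂ = -a₂ :=
    ⟨(a₁ + s) / 2, (a₁ - s) / 2, by ring, by linear_combination -hs / 4⟩
  have hlt : ∀ m : ℂ, m ^ 2 - a₁ * m - a₂ = 0 → ‖m‖ < 1 := by
    intro m hm
    by_contra hge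
    have hm0 : m ≠ 0 := by rintro rfl; simp at hge
    refine hroot m⁻¹ ?_ ?_
    · rw [norm_inv]; exact inv_le_one_of_one_le₀ (not_lt.1 hge)
    · field_simp
      linear_combination hm
  have h₁ : ‖m₁‖ < 1 := hlt _ (by rw [← hsum]; linear_combination -hprod)
  have h₂ : ‖m₂‖ < 1 := hlt _ (by rw [← hsum]; linear_combination -hprod)
  let g : ℕ → ℂ := fun n => ∑ kl ∈ Finset.HasAntidiagonal.antidiagonal n, m₁ ^ kl.1 * m₂ ^ kl.2
  have hg : Summable fun n => ‖g n‖ :=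
    summable_norm_sum_mul_antidiagonal_of_summable_norm
      (by simpa [norm_pow] using summable_geometric_of_lt_one (norm_nonneg _) h₁)
      (by simpa [norm_pow] using summable_geometric_of_lt_one (norm_nonneg _) h₂)
  have hstep : ∀ n, g (n + 1) = m₁ * g n + m₂ ^ (n + 1) := by
    intro n
    simp only [g]
    rw [Finset.Nat.sum_antidiagonal_succ, Finset.mul_sum]
    simp only [pow_succ]
    rw [add_comm]
    congr 1
    · exact Finset.sum_congr rfl fun kl _ => by ring
    · simp
  have heq : ∀ n, g n = impulse a₁ a₂ n ∧ g (n + 1) = impulse a₁ a₂ (n + 1) := by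
    intro n
    induction n with
    | zero =>
      have h0 : g 0 = 1 := by simp [g]
      refine ⟨by simp [h0, impulse], ?_⟩
      rw [hstep, h0]; simp [impulse, hsum]
    | succ n ih =>
      refine ⟨ih.2, ?_⟩
      have e1 := hstep n
      have e2 := hstep (n + 1)
      rw [impulse_add_two]; push_cast
      rw [← ih.1, ← ih.2, e2]
      linear_combination (-m₂) * e1 + g (n + 1) * hsum - g n * hprod
  refine hg.congr fun n => ?_
  rw [(heq n).1, Complex.norm_real, Real.norm_eq_abs]

theorem tendsto_impulse
    (hroot : ∀ z : ℂ, ‖z‖ ≤ 1 → 1 - a₁ * z - a₂ * z ^ 2 ≠ 0) :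
    Tendsto (impulse a₁ a₂) atTop (𝓝 0) :=
  (tendsto_zero_iff_abs_tendsto_zero _).2 (summable_abs_impulse hroot).tendsto_atTop_zero

/-- Unrolling `x k - a₁ x (k - 1) - a₂ x (k - 2) = u k` over `n + 1` steps. -/
theorem eq_sum_impulse_mul_add {x u : ℤ → ℝ}
    (h : ∀ k, x k - a₁ * x (k - 1) - a₂ * x (k - 2) = u k) (n : ℕ) (m : ℤ) :
    x (m + n + 2) = ∑ k ∈ Finset.range (n + 1), impulse a₁ a₂ k * u (m + n + 2 - k)
      + (impulse a₁ a₂ (n + 1) * x (m + 1) + a₂ * impulse a₁ a₂ n * x m) := by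
  induction n generalizing m with
  | zero =>
    have := h (m + 2)
    rw [show m + 2 - 1 = m + 1 by ring, show m + 2 - 2 = m by ring] at this
    simp [impulse]; linarith
  | succ n ih =>
    have h1 := ih (m + 1)
    have h2 := h (m + 2)
    rw [show m + 2 - 1 = m + 1 by ring, show m + 2 - 2 = m by ring] at h2
    rw [Finset.sum_range_succ]
    have e : m + ((n + 1 : ℕ) : ℤ) + 2 = m + 1 + n + 2 := by push_cast; ring
    rw [e, h1, impulse_add_two,
      show m + 1 + (n : ℤ) + 2 - ((n + 1 : ℕ) : ℤ) = m + 2 by push_cast; ring,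
      show m + 1 + 1 = m + 2 by ring, ← h2]
    ring

/-- Every solution of a causal recursion tends to zero. -/
theorem tendsto_zero_of_recursion
    (hroot : ∀ z : ℂ, ‖z‖ ≤ 1 → 1 - a₁ * z - a₂ * z ^ 2 ≠ 0) {s : ℕ → ℝ}
    (hs : ∀ n, s (n + 2) = a₁ * s (n + 1) + a₂ * s n) : Tendsto s atTop (𝓝 0) := by
  have h : ∀ n, s (n + 2) = impulse a₁ a₂ (n + 1) * s 1 + a₂ * impulse a₁ a₂ n * s 0 ∧
      s (n + 3) = impulse a₁ a₂ (n + 2) * s 1 + a₂ * impulse a₁ a₂ (n + 1) * s 0 := by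
    intro n
    induction n with
    | zero =>
      have h0 := hs 0
      have h1 := hs 1
      simp only [zero_add] at h0 h1 ⊢
      rw [show (1 : ℕ) + 2 = 3 from rfl, show (1 : ℕ) + 1 = 2 from rfl] at h1
      refine ⟨by rw [h0]; simp [impulse], ?_⟩
      rw [h1, h0]; simp [impulse]; ring
    | succ n ih =>
      refine ⟨ih.2, ?_⟩
      rw [hs (n + 2), show n + 2 + 1 = n + 3 from rfl, ih.1, ih.2, impulse_add_two (n + 1),
        impulse_add_two n]
      ring
  have ht := tendsto_impulse hroot
  rw [← tendsto_add_atTop_iff_nat 2]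
  have := (((tendsto_add_atTop_iff_nat 1).2 ht).mul_const (s 1)).add
    ((ht.const_mul a₂).mul_const (s 0))
  simp only [zero_mul, mul_zero, add_zero] at this
  exact this.congr fun n => (h n).1.symm

/-- The Yule-Walker equations determine the autocovariances. -/
theorem eq_of_yuleWalker {c g : ℕ → ℝ} {r s : ℝ} (h₁ : 1 - a₁ - a₂ ≠ 0) (h₂ : 1 + a₁ - a₂ ≠ 0)
    (h₃ : 1 + a₂ ≠ 0) (hc₀ : c 0 - a₁ * c 1 - a₂ * c 2 = r) (hc₁ : c 1 - a₁ * c 0 - a₂ * c 1 = s)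
    (hc : ∀ n, c (n + 2) = a₁ * c (n + 1) + a₂ * c n) (hg₀ : g 0 - a₁ * g 1 - a₂ * g 2 = r)
    (hg₁ : g 1 - a₁ * g 0 - a₂ * g 1 = s) (hg : ∀ n, g (n + 2) = a₁ * g (n + 1) + a₂ * g n) :
    g = c := by
  have hc2 := hc 0
  have hg2 := hg 0
  simp only [zero_add] at hc2 hg2
  have e0 : (1 + a₂) * ((1 - a₁ - a₂) * ((1 + a₁ - a₂) * (g 0 - c 0))) = 0 := by
    linear_combination (1 - a₂) * (hg₀ - hc₀) + (1 - a₂) * a₂ * (hg2 - hc2)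
      + a₁ * (1 + a₂) * (hg₁ - hc₁)
  have h0 : g 0 = c 0 := by
    simpa [h₁, h₂, h₃, sub_eq_zero] using e0
  have h1 : g 1 = c 1 := by
    have e1 : (1 - a₂) * (g 1 - c 1) = 0 := by linear_combination hg₁ - hc₁ + a₁ * h0
    rcases mul_eq_zero.1 e1 with h | h
    · -- If `a₂ = 1`, the first equation still determines `g 1`, because then `a₁ ≠ 0`.
      have ha : a₂ = 1 := by linarith
      have ha1 : a₁ ≠ 0 := by rintro rfl; apply h₁; rw [ha]; ring
      have e2 : a₁ * (2 * (g 1 - c 1)) = 0 := by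
        subst ha
        linear_combination -(hg₀ - hc₀) - (hg2 - hc2)
      have := (mul_eq_zero.1 e2).resolve_left ha1
      linarith
    · linarith
  have key : ∀ n, g n = c n ∧ g (n + 1) = c (n + 1) := by
    intro n
    induction n with
    | zero => exact ⟨h0, h1⟩
    | succ n ih => exact ⟨ih.2, by rw [hg, hc, ih.1, ih.2]⟩
  exact funext fun n => (key n).1

/-- The system `v (1 + θ²) = r`, `v θ = s` has a solution with `|θ| < 1` as soon as
`2 |s| < r`, that is when the function `r + 2 s cos x` is positive. -/
theorem exists_ma_parameters {r s : ℝ} (h : 2 * |s| < r) :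
    ∃ (θ : ℝ) (v : ℝ≥0), |θ| < 1 ∧ 0 < v ∧ v * (1 + θ ^ 2) = r ∧ v * θ = s := by
  have hr : 0 < r := lt_of_le_of_lt (by positivity) h
  have hdisc : 0 ≤ r ^ 2 - 4 * s ^ 2 := by
    have := sq_abs s
    nlinarith [abs_nonneg s]
  set D := Real.sqrt (r ^ 2 - 4 * s ^ 2) with hD
  have hD2 : D ^ 2 = r ^ 2 - 4 * s ^ 2 := Real.sq_sqrt hdisc
  have hD0 : 0 ≤ D := Real.sqrt_nonneg _
  have hpos : 0 < r + D := by linarith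
  obtain ⟨v, hv⟩ : ∃ v : ℝ≥0, (v : ℝ) = (r + D) / 2 := ⟨⟨(r + D) / 2, by positivity⟩, rfl⟩
  refine ⟨2 * s / (r + D), v, ?_, ?_, ?_, ?_⟩
  · rw [abs_div, abs_of_pos hpos, div_lt_one hpos, abs_mul, abs_two]; linarith
  · rw [← NNReal.coe_pos, hv]; positivity
  · rw [hv]
    field_simp
    linear_combination hD2
  · rw [hv]
    field_simp

/-- Exchanging `θ` for `θ⁻¹` is the only ambiguity of the system `v (1 + θ²) = r`, `v θ = s`, and it
is excluded by `|θ| < 1`. -/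
theorem ma_parameters_unique {θ θ' v v' : ℝ} (hθ : |θ| < 1) (hθ' : |θ'| < 1)
    (h0 : v * (1 + θ ^ 2) ≠ 0) (h1 : v' * (1 + θ' ^ 2) = v * (1 + θ ^ 2))
    (h2 : v' * θ' = v * θ) : θ' = θ ∧ v' = v := by
  have hv : v ≠ 0 := left_ne_zero_of_mul h0
  have hv' : v' ≠ 0 := left_ne_zero_of_mul (h1 ▸ h0)
  have e : v * v' * ((θ' - θ) * (1 - θ * θ')) = 0 := by
    linear_combination (-(v * θ)) * h1 + v * (1 + θ ^ 2) * h2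
  have hlt : θ * θ' < 1 := by
    have : |θ * θ'| < 1 := by
      rw [abs_mul]; exact mul_lt_one_of_nonneg_of_lt_one_left (abs_nonneg _) hθ hθ'.le
    exact (abs_lt.1 this).2
  have : θ' = θ := by
    have hne : 1 - θ * θ' ≠ 0 := by linarith
    have := (mul_eq_zero.1 e).resolve_left (mul_ne_zero hv hv')
    have := (mul_eq_zero.1 this).resolve_right hne
    linarith
  subst this
  refine ⟨rfl, ?_⟩
  have : (1 + θ' ^ 2) ≠ 0 := right_ne_zero_of_mul h0
  exact mul_right_cancel₀ this h1

end Recursion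

/-! ### The autoregressive and moving average polynomials -/

section Polynomials

variable {a₁ a₂ θ : ℝ}

theorem arPoly_two (a₁ a₂ : ℝ) : arPoly ![a₁, a₂]
    = 1 - Polynomial.C a₁ * Polynomial.X - Polynomial.C a₂ * Polynomial.X ^ 2 := by
  simp [arPoly, Fin.sum_univ_two, sub_sub]

theorem maPoly_one (θ : ℝ) : maPoly ![θ] = 1 + Polynomial.C θ * Polynomial.X := by
  simp [maPoly]

theorem isCausal_two_iff : IsCausal ![a₁, a₂] ↔
    ∀ z : ℂ, ‖z‖ ≤ 1 → 1 - a₁ * z - a₂ * z ^ 2 ≠ 0 := by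
  simp [IsCausal, arPoly_two]

theorem isInvertibleMA_one (hθ : |θ| < 1) : IsInvertibleMA ![θ] := by
  intro z hz h
  simp only [maPoly_one, map_add, map_one, map_mul, Polynomial.aeval_C, Polynomial.aeval_X,
    Complex.coe_algebraMap] at h
  have h1 : ‖(θ : ℂ) * z‖ = 1 := by
    rw [eq_neg_of_add_eq_zero_right h]; simp
  rw [norm_mul, Complex.norm_real, Real.norm_eq_abs] at h1
  have := mul_lt_one_of_nonneg_of_lt_one_left (abs_nonneg θ) hθ hz
  linarith

/-- If the two polynomials of an ARMA(2,1) model had a common zero, the model would reduce to an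
AR(1) model, whose autocovariances form a geometric sequence. -/
theorem isCoprime_of_sq_ne {c₀ c₁ c₂ v : ℝ} (hθ : |θ| < 1) (ha₂ : 1 + a₂ ≠ 0)
    (h2 : c₂ = a₁ * c₁ + a₂ * c₀) (hv₀ : v * (1 + θ ^ 2 + θ * a₁) = c₀ - c₁ * a₁ - c₂ * a₂)
    (hv₁ : v * θ = c₁ * (1 - a₂) - c₀ * a₁) (hc : c₁ ^ 2 ≠ c₀ * c₂) :
    IsCoprime (arPoly ![a₁, a₂]) (maPoly ![θ]) := by
  rw [Polynomial.isCoprime_iff_aeval_ne_zero_of_isAlgClosed ℝ ℂ]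
  by_contra! hcon
  obtain ⟨z, hz₁, hz₂⟩ := hcon
  simp [arPoly_two] at hz₁
  simp [maPoly_one] at hz₂
  have hC : (θ : ℂ) ^ 2 + a₁ * θ - a₂ = 0 := by
    linear_combination (θ : ℂ) ^ 2 * hz₁ + (a₁ * θ + a₂ * θ * z - a₂) * hz₂
  have hR : a₂ = θ ^ 2 + a₁ * θ := by
    have : θ ^ 2 + a₁ * θ - a₂ = 0 := by exact_mod_cast hC
    linarith
  -- The factorization is `1 - a₁ z - a₂ z² = (1 + θ z) (1 - ρ z)` with `ρ = a₁ + θ`.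
  have hθ2 : 1 - θ ^ 2 ≠ 0 := by
    have := (sq_lt_one_iff_abs_lt_one θ).2 hθ
    linarith
  have hd : (1 - θ ^ 2) * ((1 + a₂) * (c₁ - (a₁ + θ) * c₀)) = 0 := by
    subst h2 hR
    linear_combination θ * hv₀ - (1 + θ ^ 2 + θ * a₁) * hv₁
  have hd' : c₁ = (a₁ + θ) * c₀ := by
    simpa [hθ2, ha₂, sub_eq_zero] using hd
  apply hc
  rw [h2, hR, hd']; ring

end Polynomials

/-! ### Discrete time consequences of the energy decay -/

section Sampling

variable {γ α : ℝ}

/-- The Cayley-Hamilton theorem for `exp (h A)`, applied to the row `(u, w) exp (t A)`. -/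
theorem recursion_of_row (h t u w : ℝ) {a₁ a₂ : ℝ}
    (ha₁ : a₁ = (langevinPropagator γ α h).trace) (ha₂ : a₂ = -Real.exp (-γ * h)) :
    rowA γ α u w (t + h + h) = a₁ * rowA γ α u w (t + h) + a₂ * rowA γ α u w t ∧
    rowB γ α u w (t + h + h) = a₁ * rowB γ α u w (t + h) + a₂ * rowB γ α u w t := by
  rw [ha₁, ha₂, trace_langevinPropagator, ← flow_det]
  simp only [rowA, rowB, flowP_add, flowQ_add]
  constructor <;> ring

/-- The sampled Langevin dynamics is causal: an eigenvector of `exp (h A)` for an eigenvalue of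
modulus at least one would contradict the energy decay. -/
theorem langevin_causal (hγ : 0 < γ) (hα : 0 < α) {h : ℝ} (hh : 0 < h) (hq : flowQ γ α h ≠ 0)
    {a₁ a₂ : ℝ} (ha₁ : a₁ = (langevinPropagator γ α h).trace) (ha₂ : a₂ = -Real.exp (-γ * h))
    (z : ℂ) (hz : ‖z‖ ≤ 1) : 1 - a₁ * z - a₂ * z ^ 2 ≠ 0 := by
  intro hzero
  rw [trace_langevinPropagator] at ha₁
  rw [← flow_det (α := α)] at ha₂
  set p := flowP γ α h with hp
  set q := flowQ γ α h with hqdef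
  have hz0 : z ≠ 0 := by rintro rfl; simp at hzero
  -- The row vector `(u, w)` satisfies `z (u, w) exp (h A) = (u, w)`.
  let u : ℂ := 1 - z * (p - γ * q)
  let w : ℂ := z * q
  have hw0 : w ≠ 0 := mul_ne_zero hz0 (by exact_mod_cast hq)
  have e₁ : u = z * (u * p + w * (-α * q)) := by
    simp only [u, w]
    rw [ha₁, ha₂] at hzero
    push_cast at hzero
    linear_combination hzero
  have e₂ : w = z * (u * q + w * (p - γ * q)) := by simp only [u, w]; ring
  have hnz : Complex.normSq z ≤ 1 := by
    rw [Complex.normSq_eq_norm_sq]; exact pow_le_one₀ (norm_nonneg _) hz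
  have n₁ : Complex.normSq u ≤ rowA γ α u.re w.re h ^ 2 + rowA γ α u.im w.im h ^ 2 := by
    have : Complex.normSq (u * p + w * (-α * q))
        = rowA γ α u.re w.re h ^ 2 + rowA γ α u.im w.im h ^ 2 := by
      simp [Complex.normSq_apply, rowA, ← hp, ← hqdef]; ring
    rw [← this]
    conv_lhs => rw [e₁, Complex.normSq_mul]
    exact mul_le_of_le_one_left (Complex.normSq_nonneg _) hnz
  have n₂ : Complex.normSq w ≤ rowB γ α u.re w.re h ^ 2 + rowB γ α u.im w.im h ^ 2 := by
    have : Complex.normSq (u * q + w * (p - γ * q))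
        = rowB γ α u.re w.re h ^ 2 + rowB γ α u.im w.im h ^ 2 := by
      simp [Complex.normSq_apply, rowB, ← hp, ← hqdef]; ring
    rw [← this]
    conv_lhs => rw [e₂, Complex.normSq_mul]
    exact mul_le_of_le_one_left (Complex.normSq_nonneg _) hnz
  rw [Complex.normSq_apply] at n₁ n₂
  have hlt : ∀ u w : ℝ, u ≠ 0 ∨ w ≠ 0 →
      rowA γ α u w h ^ 2 / α + rowB γ α u w h ^ 2 < u ^ 2 / α + w ^ 2 := fun u w huw => by
    have := (isRowFlow_row γ α u w).energy_lt hγ hα hh (by simpa using huw)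
    simpa using this
  have hle : ∀ u w : ℝ, rowA γ α u w h ^ 2 / α + rowB γ α u w h ^ 2 ≤ u ^ 2 / α + w ^ 2 := by
    intro u w
    by_cases huw : u ≠ 0 ∨ w ≠ 0
    · exact (hlt u w huw).le
    · push Not at huw
      simp [huw.1, huw.2, rowA, rowB]
  have n₁' := div_le_div_of_nonneg_right n₁ hα.le
  rw [add_div, add_div] at n₁'
  have hwne : w.re ≠ 0 ∨ w.im ≠ 0 := by
    by_contra! hcon
    exact hw0 (Complex.ext hcon.1 hcon.2)
  rcases hwne with hne | hne
  · have := hlt u.re w.re (Or.inr hne)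
    have := hle u.im w.im
    simp only [sq] at *
    linarith
  · have := hlt u.im w.im (Or.inr hne)
    have := hle u.re w.re
    simp only [sq] at *
    linarith

/-- Positivity of the spectral density of the moving average part of the sampled process. The
quantities `r ± 2 s` are losses of energy over one step, started from `(1 ∓ E₂₂, ± E₁₂)` with
`E = exp (h A)`. -/
theorem langevin_two_mul_abs_lt (hγ : 0 < γ) (hα : 0 < α) {h : ℝ} (hh : 0 < h)
    (hq : flowQ γ α h ≠ 0) {a₁ a₂ c₀ c₁ c₂ : ℝ}
    (ha₁ : a₁ = (langevinPropagator γ α h).trace) (ha₂ : a₂ = -Real.exp (-γ * h))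
    (hc₀ : 0 < c₀) (hc₁ : c₁ = c₀ * flowP γ α h) (hc₂ : c₂ = c₀ * flowP γ α (h + h)) :
    2 * |c₁ * (1 - a₂) - c₀ * a₁|
      < (c₀ - c₁ * a₁ - c₂ * a₂) - a₁ * (c₁ * (1 - a₂) - c₀ * a₁) := by
  rw [trace_langevinPropagator] at ha₁
  rw [← flow_det (α := α)] at ha₂
  rw [flowP_add] at hc₂
  have hlt : ∀ e : ℝ, e ^ 2 = 1 →
      rowA γ α (1 - e * (flowP γ α h - γ * flowQ γ α h)) (e * flowQ γ α h) h ^ 2 / α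
        + rowB γ α (1 - e * (flowP γ α h - γ * flowQ γ α h)) (e * flowQ γ α h) h ^ 2
      < (1 - e * (flowP γ α h - γ * flowQ γ α h)) ^ 2 / α + (e * flowQ γ α h) ^ 2 := by
    intro e he
    have he0 : e ≠ 0 := by rintro rfl; norm_num at he
    have := (isRowFlow_row γ α (1 - e * (flowP γ α h - γ * flowQ γ α h))
      (e * flowQ γ α h)).energy_lt hγ hα hh (Or.inr (by simp [he0, hq]))
    simpa using this
  have h₁ := mul_lt_mul_of_pos_left (hlt 1 (by norm_num)) (mul_pos hc₀ hα)
  have h₂ := mul_lt_mul_of_pos_left (hlt (-1) (by norm_num)) (mul_pos hc₀ hα)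
  simp only [rowA, rowB] at h₁ h₂
  set p := flowP γ α h
  set q := flowQ γ α h
  have cancel : ∀ x y : ℝ, c₀ * α * (x / α + y) = c₀ * (x + α * y) := by
    intro x y; field_simp
  rw [cancel, cancel] at h₁ h₂
  subst ha₁ ha₂ hc₁ hc₂
  rw [← abs_two, ← abs_mul, abs_two, abs_lt]
  constructor
  · linarith
  · linarith

/-- The autocovariances of the sampled process are not geometric: `c₁² - c₀ c₂ = α (c₀ E₁₂)²` with
`E = exp (h A)`. -/
theorem langevin_sq_ne (hα : 0 < α) {h : ℝ} (hq : flowQ γ α h ≠ 0) {c₀ c₁ c₂ : ℝ}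
    (hc₀ : 0 < c₀) (hc₁ : c₁ = c₀ * flowP γ α h) (hc₂ : c₂ = c₀ * flowP γ α (h + h)) :
    c₁ ^ 2 ≠ c₀ * c₂ := by
  rw [flowP_add] at hc₂
  intro heq
  have : α * (c₀ * flowQ γ α h) ^ 2 = 0 := by rw [hc₁, hc₂] at heq; linarith
  have := (mul_eq_zero.1 this).resolve_left hα.ne'
  exact mul_ne_zero hc₀.ne' hq (pow_eq_zero_iff (two_ne_zero) |>.1 this)

end Sampling

/-! ### Integrals of Brownian paths -/

section BrownianIntegral

/-- Left endpoint Riemann sums of a continuous function converge to its integral. -/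
theorem tendsto_riemannSum {f : ℝ → ℝ} (hf : Continuous f) {t : ℝ} (ht : 0 ≤ t) :
    Tendsto (fun N : ℕ => ∑ i ∈ Finset.range N, t / N * f (i * (t / N))) atTop
      (𝓝 (∫ s in (0 : ℝ)..t, f s)) := by
  rw [Metric.tendsto_atTop]
  intro ε hε
  have huc := isCompact_Icc.uniformContinuousOn_of_continuous (hf.continuousOn (s := Set.Icc 0 t))
  rw [Metric.uniformContinuousOn_iff] at huc
  have hη : 0 < ε / (t + 1) := by positivity
  obtain ⟨δ, hδ, hδf⟩ := huc _ hη
  obtain ⟨N₀, hN₀⟩ := exists_nat_gt (t / δ)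
  refine ⟨N₀ + 1, fun N hN => ?_⟩
  have hNpos : 0 < (N : ℝ) := by exact_mod_cast (by omega : 0 < N)
  have hNle : (N₀ : ℝ) ≤ N := by exact_mod_cast (by omega : N₀ ≤ N)
  set τ := t / N with hτ
  have hτ0 : 0 ≤ τ := by positivity
  have hτδ : τ < δ := by
    rw [hτ, div_lt_comm₀ hNpos hδ]; linarith
  have hNτ : N * τ = t := by rw [hτ]; field_simp
  have hsplit : ∫ s in (0 : ℝ)..t, f s
      = ∑ i ∈ Finset.range N, ∫ s in (i * τ)..((i + 1 : ℕ) * τ), f s := by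
    rw [intervalIntegral.sum_integral_adjacent_intervals (a := fun i : ℕ => i * τ)
      fun k _ => hf.intervalIntegrable _ _, hNτ]
    simp
  have hterm : ∀ i ∈ Finset.range N,
      |τ * f (i * τ) - ∫ s in (i * τ)..((i + 1 : ℕ) * τ), f s| ≤ ε / (t + 1) * τ := by
    intro i hi
    have hi' : ((i + 1 : ℕ) : ℝ) ≤ N := by exact_mod_cast Finset.mem_range.1 hi
    have hconst : τ * f (i * τ) = ∫ _ in (i * τ)..((i + 1 : ℕ) * τ), f (i * τ) := by
      rw [intervalIntegral.integral_const]; push_cast; simp; left; ring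
    rw [hconst, ← intervalIntegral.integral_sub (by simp) (hf.intervalIntegrable _ _)]
    have hlen : |((i + 1 : ℕ) : ℝ) * τ - i * τ| = τ := by
      push_cast; rw [show ((i : ℝ) + 1) * τ - i * τ = τ by ring, abs_of_nonneg hτ0]
    have hle : (i : ℝ) * τ ≤ (i + 1 : ℕ) * τ := by push_cast; nlinarith
    have hmax : ((i + 1 : ℕ) : ℝ) * τ ≤ t := by
      rw [← hNτ]; exact mul_le_mul_of_nonneg_right hi' hτ0
    have h0 : 0 ≤ (i : ℝ) * τ := by positivity
    have := intervalIntegral.norm_integral_le_of_norm_le_const (a := i * τ)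
      (b := (i + 1 : ℕ) * τ) (C := ε / (t + 1)) (f := fun s => f (i * τ) - f s) fun s hs => by
        rw [Set.uIoc_of_le hle] at hs
        refine (hδf _ ⟨h0, hle.trans hmax⟩ s ⟨h0.trans hs.1.le, hs.2.trans hmax⟩ ?_).le
        rw [Real.dist_eq, abs_sub_comm, abs_of_pos (by linarith [hs.1])]
        have := hs.2
        push_cast at this
        nlinarith
    rwa [hlen] at this
  rw [Real.dist_eq, hsplit, ← Finset.sum_sub_distrib]
  calc |∑ i ∈ Finset.range N, (τ * f (i * τ) - ∫ s in (i * τ)..((i + 1 : ℕ) * τ), f s)|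
      ≤ ∑ i ∈ Finset.range N, ε / (t + 1) * τ :=
        (Finset.abs_sum_le_sum_abs _ _).trans (Finset.sum_le_sum hterm)
    _ = ε / (t + 1) * t := by
        rw [Finset.sum_const, Finset.card_range, nsmul_eq_mul, ← hNτ]; ring
    _ < ε := by
        rw [div_mul_eq_mul_div, div_lt_iff₀ (by positivity)]; nlinarith

variable {Ω : Type*} [MeasurableSpace Ω] {P : Measure Ω} {B : ℝ≥0 → Ω → ℝ}

theorem ProbabilityTheory.IsPreBrownianReal.isCenteredGaussianProcess
    (hB : IsPreBrownianReal B P) : IsCenteredGaussianProcess B P :=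
  hB.isGaussianProcess.isCenteredGaussianProcess hB.integral_eval

/-- The Riemann sums whose limit is `∫ s in 0..t, k s * B s`, as formal linear combinations of
times. -/
noncomputable def riemannComb (k : ℝ → ℝ) (t : ℝ) (N : ℕ) : ℝ≥0 →₀ ℝ :=
  ∑ i ∈ Finset.range N, Finsupp.single (i * (t / N)).toNNReal (t / N * k (i * (t / N)))

theorem linearCombination_riemannComb (k : ℝ → ℝ) (t : ℝ) (N : ℕ) (b : ℝ≥0 → ℝ) :
    Finsupp.linearCombination ℝ b (riemannComb k t N)
      = ∑ i ∈ Finset.range N, t / N * k (i * (t / N)) * b (i * (t / N)).toNNReal := by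
  simp only [riemannComb, map_sum, Finsupp.linearCombination_single, smul_eq_mul]

theorem ae_tendsto_riemannComb (hB : IsBrownianReal B P) {k : ℝ → ℝ} (hk : Continuous k)
    {t : ℝ} (ht : 0 ≤ t) : ∀ᵐ ω ∂P, Tendsto (fun N =>
      Finsupp.linearCombination ℝ (fun t => B t ω) (riemannComb k t N)) atTop
      (𝓝 (∫ s in (0 : ℝ)..t, k s * B s.toNNReal ω)) := by
  filter_upwards [hB.cont] with ω hω
  have hc : Continuous fun s : ℝ => k s * B s.toNNReal ω :=
    hk.mul (hω.comp continuous_real_toNNReal)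
  refine (tendsto_riemannSum hc ht).congr fun N => ?_
  rw [linearCombination_riemannComb]
  exact Finset.sum_congr rfl fun i _ => by ring

theorem isLinearLimit_integral (hB : IsBrownianReal B P) {k : ℝ → ℝ} (hk : Continuous k)
    {t : ℝ} (ht : 0 ≤ t) :
    IsLinearLimit B (fun ω => ∫ s in (0 : ℝ)..t, k s * B s.toNNReal ω) P :=
  ⟨_, ae_tendsto_riemannComb hB hk ht⟩

theorem variance_integral_le [IsProbabilityMeasure P] (hB : IsBrownianReal B P) {k : ℝ → ℝ}
    (hk : Continuous k) {t C : ℝ} (ht : 0 ≤ t) (hC : ∀ s ∈ Set.Icc 0 t, |k s| ≤ C) :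
    Var[fun ω => ∫ s in (0 : ℝ)..t, k s * B s.toNNReal ω; P] ≤ C ^ 2 * t ^ 3 := by
  have hGP := hB.toIsPreBrownianReal.isCenteredGaussianProcess
  have hlim := (IsLinearLimit.exists_tendsto_variance hGP
    ((isLinearLimit_integral hB hk ht).aemeasurable hGP.aemeasurable)
    (ae_tendsto_riemannComb hB hk ht)).2
  have hC0 : 0 ≤ C := (abs_nonneg _).trans (hC 0 ⟨le_rfl, ht⟩)
  refine le_of_tendsto hlim ?_
  filter_upwards [eventually_gt_atTop 0] with N hN
  have hNpos : (0 : ℝ) < N := by exact_mod_cast hN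
  set τ := t / N with hτ
  have hτ0 : 0 ≤ τ := by positivity
  have hNτ : N * τ = t := by rw [hτ]; field_simp
  have hmem : ∀ i ∈ Finset.range N, (i : ℝ) * τ ∈ Set.Icc 0 t := by
    intro i hi
    have hi' : (i : ℝ) ≤ N := by exact_mod_cast (Finset.mem_range.1 hi).le
    exact ⟨by positivity, by rw [← hNτ]; exact mul_le_mul_of_nonneg_right hi' hτ0⟩
  simp_rw [linearCombination_riemannComb, ← hτ]
  rw [variance_fun_sum' fun i _ => (hGP.eval _).memLp_two.const_mul _]
  have hterm : ∀ i ∈ Finset.range N, ∀ j ∈ Finset.range N,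
      cov[fun ω => τ * k (i * τ) * B (i * τ).toNNReal ω,
        fun ω => τ * k (j * τ) * B (j * τ).toNNReal ω; P] ≤ (τ * C) * ((τ * C) * t) := by
    intro i hi j hj
    rw [covariance_const_mul_left, covariance_const_mul_right, hB.covariance_eval]
    have hcoef : ∀ i ∈ Finset.range N, |τ * k (i * τ)| ≤ τ * C := fun i hi => by
      rw [abs_mul, abs_of_nonneg hτ0]
      exact mul_le_mul_of_nonneg_left (hC _ (hmem i hi)) hτ0
    have hmin : |((min (i * τ).toNNReal (j * τ).toNNReal : ℝ≥0) : ℝ)| ≤ t := by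
      rw [abs_of_nonneg (NNReal.coe_nonneg _), NNReal.coe_min]
      refine (min_le_left _ _).trans ?_
      rw [Real.coe_toNNReal _ (hmem i hi).1]
      exact (hmem i hi).2
    refine (le_abs_self _).trans ?_
    rw [abs_mul (τ * k (i * τ)), abs_mul (τ * k (j * τ))]
    exact mul_le_mul (hcoef i hi) (mul_le_mul (hcoef j hj) hmin (abs_nonneg _) (by positivity))
      (by positivity) (by positivity)
  calc _ ≤ ∑ i ∈ Finset.range N, ∑ j ∈ Finset.range N, (τ * C) * ((τ * C) * t) :=
        Finset.sum_le_sum fun i hi => Finset.sum_le_sum fun j hj => hterm i hi j hj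
    _ = C ^ 2 * (N * τ) ^ 2 * t := by
        simp only [Finset.sum_const, Finset.card_range, nsmul_eq_mul]; ring
    _ = C ^ 2 * t ^ 3 := by rw [hNτ]; ring

/-- For short times the variance of `w B_t + ∫ s in 0..t, k s * B s` is `w² t + O(t²)`. -/
theorem abs_variance_add_integral_sub_le [IsProbabilityMeasure P] (hB : IsBrownianReal B P)
    {k : ℝ → ℝ} (hk : Continuous k) {t : ℝ≥0} {C : ℝ} (ht : 0 < t) (ht1 : t ≤ 1)
    (hC : ∀ s ∈ Set.Icc (0 : ℝ) t, |k s| ≤ C) (w : ℝ) :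
    |Var[fun ω => w * B t ω + ∫ s in (0 : ℝ)..t, k s * B s.toNNReal ω; P] - w ^ 2 * t|
      ≤ (w ^ 2 + 2 * C ^ 2) * t ^ 2 := by
  have hGP := hB.toIsPreBrownianReal.isCenteredGaussianProcess
  set J : Ω → ℝ := fun ω => ∫ s in (0 : ℝ)..t, k s * B s.toNNReal ω with hJ
  have hJ2 : MemLp J 2 P :=
    ((isLinearLimit_integral hB hk t.2).isCenteredGaussian hGP).memLp_two
  have hBt : MemLp (B t) 2 P := (hGP.eval t).memLp_two
  have hvJ : Var[J; P] ≤ C ^ 2 * t ^ 3 := variance_integral_le hB hk t.2 hC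
  have hvB : Var[B t; P] = t := by rw [(hB.hasLaw_eval t).variance_eq]; simp
  have ht' : (0 : ℝ) < t := ht
  have ht1' : (t : ℝ) ≤ 1 := ht1
  -- Rescaling the first variable by `t` balances the two terms of the Cauchy-Schwarz bound.
  have hcs := abs_covariance_le (hBt.const_mul (t * w)) hJ2
  rw [covariance_const_mul_left, variance_const_mul, hvB, mul_assoc, abs_mul, abs_of_pos ht'] at hcs
  have hcs' : |w * cov[B t, J; P]| ≤ (w ^ 2 + C ^ 2) / 2 * t ^ 2 := by
    refine le_of_mul_le_mul_left ?_ ht'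
    calc (t : ℝ) * |w * cov[B t, J; P]| ≤ _ := hcs
      _ ≤ ((t * w) ^ 2 * t + C ^ 2 * t ^ 3) / 2 := by linarith
      _ = _ := by ring
  rw [variance_fun_add (hBt.const_mul w) hJ2, variance_const_mul, hvB, covariance_const_mul_left]
  have hvJ0 := variance_nonneg J P
  have hcube : C ^ 2 * (t : ℝ) ^ 3 ≤ C ^ 2 * t ^ 2 := by
    have : (t : ℝ) ^ 3 ≤ t ^ 2 := pow_le_pow_of_le_one ht'.le ht1' (by norm_num)
    exact mul_le_mul_of_nonneg_left this (sq_nonneg C)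
  rw [abs_le] at hcs' ⊢
  constructor <;> nlinarith

end BrownianIntegral

/-! ### Stationary solutions of the Langevin system -/

/-- Variation of constants along a single path. The noise enters only through an ordinary integral
of the path `b`, because `g - σ b` is differentiable. -/
theorem langevin_path {γ α σ : ℝ} {f g b : ℝ≥0 → ℝ} (hf : Continuous f) (hg : Continuous g)
    (hb : Continuous b) (eqf : ∀ t : ℝ≥0, f t = f 0 + ∫ s in (0 : ℝ)..t, g s.toNNReal)
    (eqg : ∀ t : ℝ≥0, g t = g 0
      + (∫ s in (0 : ℝ)..t, (-γ * g s.toNNReal - α * f s.toNNReal)) + σ * b t)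
    {a β : ℝ → ℝ} (hab : IsRowFlow γ α a β) (t : ℝ≥0) :
    a 0 * f t + β 0 * g t = a t * f 0 + β t * g 0
      + σ * (β 0 * b t + ∫ s in (0 : ℝ)..t, (a (t - s) - γ * β (t - s)) * b s.toNNReal) := by
  have hF : Continuous fun s : ℝ => f s.toNNReal := hf.comp continuous_real_toNNReal
  have hG : Continuous fun s : ℝ => g s.toNNReal := hg.comp continuous_real_toNNReal
  have hB : Continuous fun s : ℝ => b s.toNNReal := hb.comp continuous_real_toNNReal
  have hH : Continuous fun s : ℝ => -γ * g s.toNNReal - α * f s.toNNReal :=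
    (hG.const_mul _).sub (hF.const_mul _)
  let F : ℝ → ℝ := fun r => f 0 + ∫ s in (0 : ℝ)..r, g s.toNNReal
  let G : ℝ → ℝ := fun r => g 0 + ∫ s in (0 : ℝ)..r, (-γ * g s.toNNReal - α * f s.toNNReal)
  have hF' : ∀ r, HasDerivAt F (g r.toNNReal) r := fun r =>
    (intervalIntegral.integral_hasDerivAt_right (hG.intervalIntegrable _ _)
      (hG.stronglyMeasurableAtFilter _ _) hG.continuousAt).const_add (f 0)
  have hG' : ∀ r, HasDerivAt G (-γ * g r.toNNReal - α * f r.toNNReal) r := fun r =>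
    (intervalIntegral.integral_hasDerivAt_right (hH.intervalIntegrable _ _)
      (hH.stronglyMeasurableAtFilter _ _) hH.continuousAt).const_add (g 0)
  have eF : ∀ r : ℝ, 0 ≤ r → F r = f r.toNNReal := fun r hr => by
    rw [eqf, Real.coe_toNNReal r hr]
  have eG : ∀ r : ℝ, 0 ≤ r → G r = g r.toNNReal - σ * b r.toNNReal := fun r hr => by
    rw [eqg, Real.coe_toNNReal r hr]; simp only [G]; ring
  have hac : Continuous a := continuous_iff_continuousAt.2 fun s =>
    (hab.hasDerivAt_fst s).continuousAt
  have hβc : Continuous β := continuous_iff_continuousAt.2 fun s =>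
    (hab.hasDerivAt_snd s).continuousAt
  let K : ℝ → ℝ := fun s => σ * ((a (t - s) - γ * β (t - s)) * b s.toNNReal)
  have hK : Continuous K := by
    have h1 : Continuous fun s : ℝ => a (t - s) := hac.comp (by fun_prop)
    have h2 : Continuous fun s : ℝ => β (t - s) := hβc.comp (by fun_prop)
    exact (((h1.sub (h2.const_mul γ)).mul hB).const_mul σ)
  have hderiv : ∀ s ∈ Set.uIcc (0 : ℝ) t,
      HasDerivAt (fun s => a (t - s) * F s + β (t - s) * G s) (K s) s := by
    intro s hs
    rw [Set.uIcc_of_le t.coe_nonneg] at hs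
    have hsub : HasDerivAt (fun s : ℝ => (t : ℝ) - s) (-1) s := by
      simpa using (hasDerivAt_id s).const_sub (t : ℝ)
    have h1 := (hab.hasDerivAt_fst (t - s)).comp s hsub
    have h2 := (hab.hasDerivAt_snd (t - s)).comp s hsub
    refine ((h1.mul (hF' s)).add (h2.mul (hG' s))).congr_deriv ?_
    rw [eF s hs.1, eG s hs.1]
    simp only [K, Function.comp]
    ring
  -- The function `s ↦ a (t - s) F s + β (t - s) G s` joins the two sides of the formula.
  have hint := intervalIntegral.integral_eq_sub_of_hasDerivAt hderiv (hK.intervalIntegrable _ _)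
  simp only [K, intervalIntegral.integral_const_mul] at hint
  rw [eF t t.coe_nonneg, eG t t.coe_nonneg] at hint
  simp only [F, G, sub_self, sub_zero, intervalIntegral.integral_same, add_zero,
    Real.toNNReal_coe] at hint
  linarith

theorem covariance_congr_ae {Ω : Type*} [MeasurableSpace Ω] {P : Measure Ω} {X X' Y Y' : Ω → ℝ}
    (hX : X =ᵐ[P] X') (hY : Y =ᵐ[P] Y') : cov[X, Y; P] = cov[X', Y'; P] := by
  simp only [covariance]
  rw [integral_congr_ae hX, integral_congr_ae hY]
  refine integral_congr_ae ?_
  filter_upwards [hX, hY] with ω h₁ h₂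
  rw [h₁, h₂]

theorem covariance_eq_of_identDistrib {Ω Ω' E : Type*} [MeasurableSpace Ω] [MeasurableSpace Ω']
    [MeasurableSpace E] {P : Measure Ω} {P' : Measure Ω'} {U : Ω → E} {V : Ω' → E}
    (h : IdentDistrib U V P P') {f g : E → ℝ} (hf : Measurable f) (hg : Measurable g) :
    cov[fun ω => f (U ω), fun ω => g (U ω); P] = cov[fun ω => f (V ω), fun ω => g (V ω); P'] := by
  rw [← covariance_map_fun hf.aestronglyMeasurable hg.aestronglyMeasurable h.aemeasurable_fst,
    ← covariance_map_fun hf.aestronglyMeasurable hg.aestronglyMeasurable h.aemeasurable_snd,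
    h.map_eq]

theorem IsStrictlyStationary.identDistrib_comp {T Ω E : Type*} [Add T] [MeasurableSpace Ω]
    [MeasurableSpace E] {X : T → Ω → E} {P : Measure Ω} (hX : IsStrictlyStationary X P)
    (s : T) {ι : Type*} [Finite ι] (τ : ι → T) :
    IdentDistrib (fun ω i => X (τ i + s) ω) (fun ω i => X (τ i) ω) P P := by
  classical
  have := Fintype.ofFinite ι
  exact (hX (Finset.univ.image τ) s).comp (u := fun (f : (Finset.univ.image τ) → E) (i : ι) =>
    f ⟨τ i, by simp⟩) (by fun_prop)

theorem IsStrictlyStationary.covariance_add {T Ω : Type*} [Add T] [MeasurableSpace Ω]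
    {X : T → Ω → ℝ} {P : Measure Ω} (hX : IsStrictlyStationary X P) (s t r : T) :
    cov[X (s + r), X (t + r); P] = cov[X s, X t; P] :=
  covariance_eq_of_identDistrib (hX.identDistrib_comp r ![s, t]) (measurable_pi_apply 0)
    (measurable_pi_apply 1)

namespace IsStationaryLangevin

variable {Ω : Type*} [MeasurableSpace Ω] {P : Measure Ω} {γ α σ : ℝ} {x y B : ℝ≥0 → Ω → ℝ}

/-- The part of `u x_t + w y_t` driven by the Brownian motion on `[0, t]`. -/
noncomputable def drivenPart (γ α σ : ℝ) (B : ℝ≥0 → Ω → ℝ) (u w : ℝ) (t : ℝ≥0) (ω : Ω) : ℝ :=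
  σ * (w * B t ω
    + ∫ s in (0 : ℝ)..t, (rowA γ α u w (t - s) - γ * rowB γ α u w (t - s)) * B s.toNNReal ω)

theorem continuous_kernel (γ α u w : ℝ) :
    Continuous fun r => rowA γ α u w r - γ * rowB γ α u w r := by
  have h := isRowFlow_row γ α u w
  have hac : Continuous (rowA γ α u w) := continuous_iff_continuousAt.2 fun s =>
    (h.hasDerivAt_fst s).continuousAt
  have hβc : Continuous (rowB γ α u w) := continuous_iff_continuousAt.2 fun s =>
    (h.hasDerivAt_snd s).continuousAt
  exact hac.sub (hβc.const_mul γ)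

theorem ae_eq (hsol : IsStationaryLangevin γ α σ x y B P) : ∀ᵐ ω ∂P, ∀ (u w : ℝ) (t : ℝ≥0),
    u * x t ω + w * y t ω = rowA γ α u w t * x 0 ω + rowB γ α u w t * y 0 ω
      + drivenPart γ α σ B u w t ω := by
  filter_upwards [hsol.cont, hsol.eq_x, hsol.eq_y, hsol.brownian.cont] with ω h1 h2 h3 h4 u w t
  have := langevin_path h1.1 h1.2 h4 h2 h3 (isRowFlow_row γ α u w) t
  simpa [drivenPart] using this

theorem isLinearLimit_drivenPart (hsol : IsStationaryLangevin γ α σ x y B P) (u w : ℝ)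
    (t : ℝ≥0) : IsLinearLimit B (drivenPart γ α σ B u w t) P :=
  (((IsLinearLimit.eval B P t).const_mul w).add (isLinearLimit_integral hsol.brownian
    ((continuous_kernel γ α u w).comp (by fun_prop : Continuous fun s : ℝ => (t : ℝ) - s))
      t.coe_nonneg)).const_mul σ

theorem indepFun_drivenPart (hsol : IsStationaryLangevin γ α σ x y B P) (u w : ℝ) (t : ℝ≥0) :
    IndepFun (fun ω => (x 0 ω, y 0 ω)) (drivenPart γ α σ B u w t) P :=
  (hsol.isLinearLimit_drivenPart u w t).indepFun hsol.indep

theorem stationary_x (hsol : IsStationaryLangevin γ α σ x y B P) :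
    IsStrictlyStationary x P := fun I s =>
  (hsol.stationary I s).comp (u := fun (f : I → ℝ × ℝ) t => (f t).1) (by fun_prop)

theorem covariance_sampled (hsol : IsStationaryLangevin γ α σ x y B P)
    (h : ℝ≥0) (k j : ℕ) :
    cov[x ((k : ℝ≥0) * h), x (((k + j : ℕ) : ℝ≥0) * h); P] = sampledAutocov x h P j := by
  have := hsol.stationary_x.covariance_add 0 ((j : ℝ≥0) * h) ((k : ℝ≥0) * h)
  rw [sampledAutocov, ← this]
  congr 2
  · simp
  · push_cast; ring

variable [IsProbabilityMeasure P]

/-- A stationary solution is a centred Gaussian process: its law agrees with that of its time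
shifts, along which the contribution of the initial condition dies out and only the driven part,
a linear functional of the Brownian motion, remains. -/
theorem isCenteredGaussian_sum (hsol : IsStationaryLangevin γ α σ x y B P) (hγ : 0 < γ)
    (hα : 0 < α) {h : ℝ≥0} (hh : 0 < h) (hq : flowQ γ α h ≠ 0) {ι : Type*} (J : Finset ι)
    (u w : ι → ℝ) (τ : ι → ℝ≥0) :
    IsCenteredGaussian (fun ω => ∑ i ∈ J, (u i * x (τ i) ω + w i * y (τ i) ω)) P := by
  have hGP := hsol.brownian.toIsPreBrownianReal.isCenteredGaussianProcess
  have hdriven : ∀ n : ℕ, IsCenteredGaussian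
      (fun ω => ∑ i ∈ J, drivenPart γ α σ B (u i) (w i) (τ i + n * h) ω) P := fun n =>
    (IsLinearLimit.sum J fun i _ => hsol.isLinearLimit_drivenPart (u i) (w i) _).isCenteredGaussian
      hGP
  obtain ⟨v, hv, -⟩ := exists_hasLaw_gaussianReal_of_tendsto
    (L := fun n ω => ∑ i ∈ J, (u i * x (τ i + n * h) ω + w i * y (τ i + n * h) ω))
    (Y := fun n ω => ∑ i ∈ J, drivenPart γ α σ B (u i) (w i) (τ i + n * h) ω)
    (Z := fun ω => ∑ i ∈ J, (u i * x (τ i) ω + w i * y (τ i) ω))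
    (fun n => by
      have := (hsol.stationary.identDistrib_comp (n * h) (fun i : J => τ i)).comp
        (u := fun f : J → ℝ × ℝ => ∑ i : J, (u i * (f i).1 + w i * (f i).2)) (by fun_prop)
      convert this using 1 <;> ext ω <;> simp only [Function.comp]
      · exact (Finset.sum_coe_sort J
          (fun i => u i * x (τ i + n * h) ω + w i * y (τ i + n * h) ω)).symm
      · exact (Finset.sum_coe_sort J (fun i => u i * x (τ i) ω + w i * y (τ i) ω)).symm)
    (fun n => (hdriven n).hasLaw) (by
      filter_upwards [hsol.ae_eq] with ω hω
      have hroot := langevin_causal hγ hα (NNReal.coe_pos.2 hh) hq rfl rfl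
      have hlim : Tendsto (fun n : ℕ => ∑ i ∈ J, (rowA γ α (u i) (w i) (τ i + n * h) * x 0 ω
          + rowB γ α (u i) (w i) (τ i + n * h) * y 0 ω)) atTop (𝓝 0) := by
        rw [show (0 : ℝ) = ∑ i ∈ J, (0 * x 0 ω + 0 * y 0 ω) by simp]
        refine tendsto_finsetSum J fun i _ => ?_
        have hrec := fun n : ℕ => recursion_of_row (h : ℝ) (τ i + n * h) (u i) (w i)
          (γ := γ) (α := α) rfl rfl
        have e1 : ∀ n : ℕ, (τ i : ℝ) + ((n + 1 : ℕ) : ℝ) * h = τ i + n * h + h := fun n => by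
          push_cast; ring
        have e2 : ∀ n : ℕ, (τ i : ℝ) + ((n + 2 : ℕ) : ℝ) * h = τ i + n * h + h + h := fun n => by
          push_cast; ring
        refine ((tendsto_zero_of_recursion hroot fun n => ?_).mul_const _).add
          ((tendsto_zero_of_recursion hroot fun n => ?_).mul_const _)
        · rw [e1 n, e2 n]; exact (hrec n).1
        · rw [e1 n, e2 n]; exact (hrec n).2
      refine hlim.congr fun n => ?_
      rw [← Finset.sum_sub_distrib]
      refine Finset.sum_congr rfl fun i _ => ?_
      rw [hω (u i) (w i) (τ i + n * h)]; push_cast; ring)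
  exact ⟨v, hv⟩

theorem isCenteredGaussian_add (hsol : IsStationaryLangevin γ α σ x y B P) (hγ : 0 < γ)
    (hα : 0 < α) {h : ℝ≥0} (hh : 0 < h) (hq : flowQ γ α h ≠ 0) (u w : ℝ) (t : ℝ≥0) :
    IsCenteredGaussian (fun ω => u * x t ω + w * y t ω) P := by
  simpa using hsol.isCenteredGaussian_sum hγ hα hh hq {()} (fun _ => u) (fun _ => w) (fun _ => t)

theorem memLp_x (hsol : IsStationaryLangevin γ α σ x y B P) (hγ : 0 < γ)
    (hα : 0 < α) {h : ℝ≥0} (hh : 0 < h) (hq : flowQ γ α h ≠ 0) (t : ℝ≥0) : MemLp (x t) 2 P := by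
  simpa using (hsol.isCenteredGaussian_add hγ hα hh hq 1 0 t).memLp_two

theorem memLp_y (hsol : IsStationaryLangevin γ α σ x y B P) (hγ : 0 < γ)
    (hα : 0 < α) {h : ℝ≥0} (hh : 0 < h) (hq : flowQ γ α h ≠ 0) (t : ℝ≥0) : MemLp (y t) 2 P := by
  simpa using (hsol.isCenteredGaussian_add hγ hα hh hq 0 1 t).memLp_two

theorem variance_add (hsol : IsStationaryLangevin γ α σ x y B P) (hγ : 0 < γ)
    (hα : 0 < α) {h : ℝ≥0} (hh : 0 < h) (hq : flowQ γ α h ≠ 0) (a b : ℝ) :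
    Var[fun ω => a * x 0 ω + b * y 0 ω; P]
    = a ^ 2 * Var[x 0; P] + 2 * a * b * cov[x 0, y 0; P] + b ^ 2 * Var[y 0; P] := by
  rw [variance_fun_add ((hsol.memLp_x hγ hα hh hq 0).const_mul a)
    ((hsol.memLp_y hγ hα hh hq 0).const_mul b), variance_const_mul, variance_const_mul,
    covariance_const_mul_left, covariance_const_mul_right]
  ring

/-- Conservation of the variance of `u x_t + w y_t`: what the initial condition has lost by the time
`t`, the Brownian motion has supplied. -/
theorem variance_stationary (hsol : IsStationaryLangevin γ α σ x y B P) (hγ : 0 < γ)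
    (hα : 0 < α) {h : ℝ≥0} (hh : 0 < h) (hq : flowQ γ α h ≠ 0) (u w : ℝ) (t : ℝ≥0) :
    Var[fun ω => u * x 0 ω + w * y 0 ω; P]
      = Var[fun ω => rowA γ α u w t * x 0 ω + rowB γ α u w t * y 0 ω; P]
        + Var[drivenPart γ α σ B u w t; P] := by
  have hstat : IdentDistrib (fun ω => u * x t ω + w * y t ω) (fun ω => u * x 0 ω + w * y 0 ω)
      P P := by
    have := (hsol.stationary.identDistrib_comp t (fun _ : Unit => 0)).comp
      (u := fun f : Unit → ℝ × ℝ => u * (f ()).1 + w * (f ()).2) (by fun_prop)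
    simpa [Function.comp_def] using this
  have hind : IndepFun (fun ω => rowA γ α u w t * x 0 ω + rowB γ α u w t * y 0 ω)
      (drivenPart γ α σ B u w t) P := (hsol.indepFun_drivenPart u w t).comp
    (φ := fun z : ℝ × ℝ => rowA γ α u w t * z.1 + rowB γ α u w t * z.2) (ψ := id)
    (by fun_prop) measurable_id
  rw [← hstat.variance_eq, ← hind.variance_fun_add]
  · exact variance_congr (hsol.ae_eq.mono fun ω hω => hω u w t)
  · exact (hsol.isCenteredGaussian_add hγ hα hh hq _ _ 0).memLp_two
  · exact ((hsol.isLinearLimit_drivenPart u w t).isCenteredGaussian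
      hsol.brownian.toIsPreBrownianReal.isCenteredGaussianProcess).memLp_two

/-- The Lyapunov equation `A S + S Aᵀ + σ² e₂ e₂ᵀ = 0` for the stationary covariance matrix `S`,
as an identity of quadratic forms. It is the derivative at `t = 0` of the conservation of the
variance of `u x_t + w y_t`. -/
theorem lyapunov (hsol : IsStationaryLangevin γ α σ x y B P) (hγ : 0 < γ)
    (hα : 0 < α) {h : ℝ≥0} (hh : 0 < h) (hq : flowQ γ α h ≠ 0) (u w : ℝ) :
    2 * (u * (-α * w) * Var[x 0; P]
      + ((-α * w) * w + u * (u - γ * w)) * cov[x 0, y 0; P]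
      + w * (u - γ * w) * Var[y 0; P]) = -(σ ^ 2 * w ^ 2) := by
  set S₁ := Var[x 0; P]
  set S₂ := cov[x 0, y 0; P]
  set S₃ := Var[y 0; P]
  let V : ℝ → ℝ := fun t => rowA γ α u w t ^ 2 * S₁
    + 2 * rowA γ α u w t * rowB γ α u w t * S₂ + rowB γ α u w t ^ 2 * S₃
  have hV : HasDerivAt V (2 * (u * (-α * w) * S₁ + ((-α * w) * w + u * (u - γ * w)) * S₂
      + w * (u - γ * w) * S₃)) 0 := by
    have hA := (isRowFlow_row γ α u w).hasDerivAt_fst 0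
    have hB := (isRowFlow_row γ α u w).hasDerivAt_snd 0
    refine ((((hA.pow 2).mul_const S₁).add (((hA.const_mul 2).mul hB).mul_const S₂)).add
      ((hB.pow 2).mul_const S₃)).congr_deriv ?_
    simp; ring
  have hslope := hV.tendsto_slope_zero_right
  obtain ⟨C, hC⟩ := isCompact_Icc.exists_bound_of_continuousOn
    ((continuous_kernel γ α u w).continuousOn (s := Set.Icc 0 1))
  have hbound : ∀ t : ℝ, 0 < t → t ≤ 1 →
      |t⁻¹ • (V (0 + t) - V 0) + σ ^ 2 * w ^ 2| ≤ σ ^ 2 * (w ^ 2 + 2 * C ^ 2) * t := by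
    intro t ht ht1
    lift t to ℝ≥0 using ht.le
    have ht' : 0 < t := ht
    have ht1' : t ≤ 1 := ht1
    have hk : Continuous fun s : ℝ =>
        rowA γ α u w (t - s) - γ * rowB γ α u w (t - s) :=
      (continuous_kernel γ α u w).comp (by fun_prop : Continuous fun s : ℝ => (t : ℝ) - s)
    have hest := abs_variance_add_integral_sub_le hsol.brownian hk ht' ht1'
      (C := C) (fun s hs => hC _ ⟨by linarith [hs.2], by linarith [hs.1]⟩) w
    have hstat := hsol.variance_stationary hγ hα hh hq u w t
    rw [hsol.variance_add hγ hα hh hq, hsol.variance_add hγ hα hh hq] at hstat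
    have hdriven : Var[drivenPart γ α σ B u w t; P] = σ ^ 2 * Var[fun ω => w * B t ω
        + ∫ s in (0 : ℝ)..t, (rowA γ α u w (t - s) - γ * rowB γ α u w (t - s))
          * B s.toNNReal ω; P] := variance_const_mul σ _ P
    have hdiff : V (0 + t) - V 0 = -Var[drivenPart γ α σ B u w t; P] := by
      simp only [V, zero_add, rowA_zero, rowB_zero]
      linarith
    rw [hdiff, hdriven, smul_eq_mul]
    set D := Var[fun ω => w * B t ω + ∫ s in (0 : ℝ)..t,
      (rowA γ α u w (t - s) - γ * rowB γ α u w (t - s)) * B s.toNNReal ω; P]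
    have e : (t : ℝ)⁻¹ * -(σ ^ 2 * D) + σ ^ 2 * w ^ 2
        = -(σ ^ 2 * (t : ℝ)⁻¹ * (D - w ^ 2 * t)) := by
      field_simp; ring
    rw [e, abs_neg, abs_mul, abs_of_nonneg (by positivity)]
    calc σ ^ 2 * (t : ℝ)⁻¹ * |D - w ^ 2 * t|
        ≤ σ ^ 2 * (t : ℝ)⁻¹ * ((w ^ 2 + 2 * C ^ 2) * t ^ 2) :=
          mul_le_mul_of_nonneg_left hest (by positivity)
      _ = _ := by field_simp
  have hlim : Tendsto (fun t : ℝ => t⁻¹ • (V (0 + t) - V 0)) (𝓝[>] 0)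
      (𝓝 (-(σ ^ 2 * w ^ 2))) := by
    rw [tendsto_iff_norm_sub_tendsto_zero]
    have hz : Tendsto (fun t : ℝ => σ ^ 2 * (w ^ 2 + 2 * C ^ 2) * t) (𝓝[>] 0) (𝓝 0) := by
      have : Tendsto (fun t : ℝ => σ ^ 2 * (w ^ 2 + 2 * C ^ 2) * t) (𝓝 0)
          (𝓝 (σ ^ 2 * (w ^ 2 + 2 * C ^ 2) * 0)) := tendsto_id.const_mul _
      rw [mul_zero] at this
      exact this.mono_left nhdsWithin_le_nhds
    refine squeeze_zero' (Eventually.of_forall fun _ => norm_nonneg _) ?_ hz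
    filter_upwards [Ioo_mem_nhdsGT one_pos] with t ht
    rw [sub_neg_eq_add]
    exact hbound t ht.1 ht.2.le
  exact tendsto_nhds_unique hslope hlim

theorem covariance_x_y (hsol : IsStationaryLangevin γ α σ x y B P) (hγ : 0 < γ)
    (hα : 0 < α) {h : ℝ≥0} (hh : 0 < h) (hq : flowQ γ α h ≠ 0) : cov[x 0, y 0; P] = 0 := by
  have := hsol.lyapunov hγ hα hh hq 1 0
  linarith

theorem variance_x (hsol : IsStationaryLangevin γ α σ x y B P) (hγ : 0 < γ)
    (hα : 0 < α) {h : ℝ≥0} (hh : 0 < h) (hq : flowQ γ α h ≠ 0) :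
    Var[x 0; P] = σ ^ 2 / (2 * α * γ) := by
  have h1 := hsol.covariance_x_y hγ hα hh hq
  have h2 := hsol.lyapunov hγ hα hh hq 0 1
  have h3 := hsol.lyapunov hγ hα hh hq 1 1
  rw [h1] at h2 h3
  rw [eq_div_iff (by positivity)]
  linear_combination -γ * h3 + (1 - γ) * (-1) * h2

theorem covariance_x (hsol : IsStationaryLangevin γ α σ x y B P) (hγ : 0 < γ)
    (hα : 0 < α) {h : ℝ≥0} (hh : 0 < h) (hq : flowQ γ α h ≠ 0) (t : ℝ≥0) :
    cov[x 0, x t; P] = Var[x 0; P] * flowP γ α t := by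
  have hx := hsol.memLp_x hγ hα hh hq
  have hy := hsol.memLp_y hγ hα hh hq
  have hd : MemLp (drivenPart γ α σ B 1 0 t) 2 P :=
    ((hsol.isLinearLimit_drivenPart 1 0 t).isCenteredGaussian
      hsol.brownian.toIsPreBrownianReal.isCenteredGaussianProcess).memLp_two
  have hind := (hsol.indepFun_drivenPart 1 0 t).comp measurable_fst measurable_id
  have hcov0 : cov[x 0, drivenPart γ α σ B 1 0 t; P] = 0 := hind.covariance_eq_zero (hx 0) hd
  have hxt : x t =ᵐ[P] (fun ω => rowA γ α 1 0 t * x 0 ω) + (fun ω => rowB γ α 1 0 t * y 0 ω)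
      + drivenPart γ α σ B 1 0 t := by
    filter_upwards [hsol.ae_eq] with ω hω
    simpa using hω 1 0 t
  have hcongr : cov[x 0, x t; P] = cov[x 0, (fun ω => rowA γ α 1 0 t * x 0 ω)
      + (fun ω => rowB γ α 1 0 t * y 0 ω) + drivenPart γ α σ B 1 0 t; P] :=
    covariance_congr_ae ae_eq_rfl hxt
  rw [hcongr, covariance_add_right (hx 0) (((hx 0).const_mul _).add ((hy 0).const_mul _)) hd,
    covariance_add_right (hx 0) ((hx 0).const_mul _) ((hy 0).const_mul _),
    covariance_const_mul_right, covariance_const_mul_right, hcov0,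
    hsol.covariance_x_y hγ hα hh hq, covariance_self (hx 0).aemeasurable]
  simp [rowA, mul_comm]

theorem isCenteredGaussianProcess_sampled (hsol : IsStationaryLangevin γ α σ x y B P)
    (hγ : 0 < γ) (hα : 0 < α) {h : ℝ≥0} (hh : 0 < h) (hq : flowQ γ α h ≠ 0) :
    IsCenteredGaussianProcess (fun (n : ℕ) => x ((n : ℝ≥0) * h)) P := by
  intro S
  have := hsol.isCenteredGaussian_sum hγ hα hh hq S.support S (fun _ => 0)
    (fun n : ℕ => (n : ℝ≥0) * h)
  simpa [Finsupp.linearCombination_apply, Finsupp.sum] using this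

end IsStationaryLangevin

/-! ### The law of a causal ARMA(2,1) process -/

namespace IsGaussianNoise

variable {Ω : Type*} [MeasurableSpace Ω] {P : Measure Ω} {v : ℝ≥0} {W : ℤ → Ω → ℝ}

theorem isCenteredGaussianProcess (hW : IsGaussianNoise v W P) :
    IsCenteredGaussianProcess W P := by
  refine IsGaussianProcess.isCenteredGaussianProcess ⟨fun I => ?_⟩ fun n => ?_
  · exact iIndepFun.hasGaussianLaw (X := fun (i : I) => W i) (fun i => (hW.law i).hasGaussianLaw)
      (hW.indep.precomp Subtype.val_injective)
  · rw [(hW.law n).integral_eq]; simp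

theorem memLp (hW : IsGaussianNoise v W P) (n : ℤ) : MemLp (W n) 2 P :=
  (hW.isCenteredGaussianProcess.eval n).memLp_two

theorem variance_eq (hW : IsGaussianNoise v W P) (n : ℤ) : Var[W n; P] = v := by
  rw [(hW.law n).variance_eq]; simp

theorem covariance_self (hW : IsGaussianNoise v W P) (n : ℤ) : cov[W n, W n; P] = v := by
  rw [ProbabilityTheory.covariance_self (hW.law n).aemeasurable, hW.variance_eq]

theorem covariance_of_ne (hW : IsGaussianNoise v W P) {m n : ℤ} (h : m ≠ n) :
    cov[W m, W n; P] = 0 :=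
  (hW.indep.indepFun h).covariance_eq_zero (hW.memLp m) (hW.memLp n)

theorem shift (hW : IsGaussianNoise v W P) (s : ℤ) : IsGaussianNoise v (fun n => W (n + s)) P :=
  ⟨hW.indep.precomp (add_left_injective s), fun n => hW.law (n + s)⟩

end IsGaussianNoise

/-- A stationary process `X` solving
`X_n - a₁ X_{n-1} - a₂ X_{n-2} = W_n + θ W_{n-1}` for a Gaussian noise `W`. -/
structure IsARMASolution {Ω : Type*} [MeasurableSpace Ω] (a₁ a₂ θ : ℝ) (v : ℝ≥0)
    (X W : ℤ → Ω → ℝ) (P : Measure Ω) : Prop where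
  stationary : IsStrictlyStationary X P
  noise : IsGaussianNoise v W P
  recursion : ∀ᵐ ω ∂P, ∀ n, X n ω - a₁ * X (n - 1) ω - a₂ * X (n - 2) ω = W n ω + θ * W (n - 1) ω

namespace IsARMASolution

variable {Ω : Type*} [MeasurableSpace Ω] {P : Measure Ω} [IsProbabilityMeasure P] {a₁ a₂ θ : ℝ}
  {v : ℝ≥0} {X W : ℤ → Ω → ℝ}

/-- As for the Langevin system, the contribution of the past dies out along the shifts, and the
rest is a linear functional of the noise. -/
theorem isCenteredGaussianProcess (hX : IsARMASolution a₁ a₂ θ v X W P)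
    (hroot : ∀ z : ℂ, ‖z‖ ≤ 1 → 1 - a₁ * z - a₂ * z ^ 2 ≠ 0) :
    IsCenteredGaussianProcess X P := by
  intro S
  let Y : ℕ → Ω → ℝ := fun n ω => ∑ t ∈ S.support, S t * ∑ k ∈ Finset.range (n + 1),
    impulse a₁ a₂ k * (W (t + n + 2 - k) ω + θ * W (t + n + 2 - k - 1) ω)
  have hY : ∀ n, IsCenteredGaussian (Y n) P := fun n =>
    (IsLinearLimit.sum _ fun t _ => (IsLinearLimit.sum _ fun k _ =>
      ((IsLinearLimit.eval W P _).add ((IsLinearLimit.eval W P _).const_mul θ)).const_mul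
        _).const_mul _).isCenteredGaussian hX.noise.isCenteredGaussianProcess
  obtain ⟨w, hw, -⟩ := exists_hasLaw_gaussianReal_of_tendsto
    (L := fun n ω => ∑ t ∈ S.support, S t * X (t + (n + 2 : ℕ)) ω) (Y := Y)
    (Z := fun ω => Finsupp.linearCombination ℝ (fun t => X t ω) S)
    (fun n => by
      have := (hX.stationary.identDistrib_comp ((n + 2 : ℕ) : ℤ)
        (fun t : S.support => (t : ℤ))).comp (u := fun f : S.support → ℝ => ∑ t : S.support, S t * f t) (by fun_prop)
      convert this using 1 <;> ext ω <;> simp only [Function.comp]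
      · exact (Finset.sum_coe_sort S.support (fun t => S t * X (t + (n + 2 : ℕ)) ω)).symm
      · rw [Finsupp.linearCombination_apply, Finsupp.sum]
        exact (Finset.sum_coe_sort S.support (fun t => S t * X t ω)).symm)
    (fun n => (hY n).hasLaw) (by
      filter_upwards [hX.recursion] with ω hω
      have himp := tendsto_impulse hroot
      have hlim : Tendsto (fun n : ℕ => ∑ t ∈ S.support, S t *
          (impulse a₁ a₂ (n + 1) * X (t + 1) ω + a₂ * impulse a₁ a₂ n * X t ω)) atTop (𝓝 0) := by
        rw [show (0 : ℝ) = ∑ t ∈ S.support, S t * (0 * X (t + 1) ω + a₂ * 0 * X t ω) by simp]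
        refine tendsto_finsetSum _ fun t _ => Tendsto.const_mul _ ?_
        exact (((tendsto_add_atTop_iff_nat 1).2 himp).mul_const _).add
          ((himp.const_mul a₂).mul_const _)
      refine hlim.congr fun n => ?_
      simp only [Y]
      rw [← Finset.sum_sub_distrib]
      refine Finset.sum_congr rfl fun t _ => ?_
      have := eq_sum_impulse_mul_add hω n t
      rw [show t + ((n + 2 : ℕ) : ℤ) = t + n + 2 by push_cast; ring, this]
      ring)
  exact ⟨w, hw⟩

/-- Covariances with a fixed random variable satisfy the recursion of the process itself. -/
theorem covariance_recursion (hX : IsARMASolution a₁ a₂ θ v X W P) (hX2 : ∀ n, MemLp (X n) 2 P)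
    {Z : Ω → ℝ} (hZ : MemLp Z 2 P) (k : ℤ) :
    cov[Z, X k; P] - a₁ * cov[Z, X (k - 1); P] - a₂ * cov[Z, X (k - 2); P]
      = cov[Z, W k; P] + θ * cov[Z, W (k - 1); P] := by
  have hW := hX.noise.memLp
  have h1 : cov[Z, fun ω => X k ω - a₁ * X (k - 1) ω - a₂ * X (k - 2) ω; P]
      = cov[Z, fun ω => W k ω + θ * W (k - 1) ω; P] := by
    have hae : (fun ω => X k ω - a₁ * X (k - 1) ω - a₂ * X (k - 2) ω)
        =ᵐ[P] fun ω => W k ω + θ * W (k - 1) ω := by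
      filter_upwards [hX.recursion] with ω hω using hω k
    exact covariance_congr_ae ae_eq_rfl hae
  have e1 := covariance_fun_sub_right (X := Z)
    (Y := fun ω => X k ω - a₁ * X (k - 1) ω) (Z := fun ω => a₂ * X (k - 2) ω) hZ
    ((hX2 k).sub ((hX2 _).const_mul _)) ((hX2 _).const_mul _)
  have e2 := covariance_fun_sub_right (X := Z)
    (Y := X k) (Z := fun ω => a₁ * X (k - 1) ω) hZ (hX2 k) ((hX2 _).const_mul _)
  have e3 : cov[Z, fun ω => W k ω + θ * W (k - 1) ω; P]
      = cov[Z, W k; P] + cov[Z, fun ω => θ * W (k - 1) ω; P] :=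
    covariance_add_right hZ (hW k) ((hW _).const_mul _)
  rw [covariance_const_mul_right] at e1 e2 e3
  rw [e1, e2, e3] at h1
  exact h1

/-- The noise is uncorrelated with the past of the process: by the recursion, a covariance of `W n`
with `X j`, `j < n`, is an arbitrarily small multiple of covariances further in the past, which are
bounded. -/
theorem covariance_noise_past (hX : IsARMASolution a₁ a₂ θ v X W P)
    (hroot : ∀ z : ℂ, ‖z‖ ≤ 1 → 1 - a₁ * z - a₂ * z ^ 2 ≠ 0) {n j : ℤ} (hj : j < n) :
    cov[W n, X j; P] = 0 := by
  have hX2 : ∀ n, MemLp (X n) 2 P := fun n =>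
    ((hX.isCenteredGaussianProcess hroot).eval n).memLp_two
  have hWn := hX.noise.memLp n
  have hvar : ∀ m, Var[X m; P] = Var[X 0; P] := fun m => by
    have := hX.stationary.covariance_add 0 0 m
    rwa [zero_add, covariance_self (hX2 m).aemeasurable, covariance_self (hX2 0).aemeasurable]
      at this
  set K := (Var[W n; P] + Var[X 0; P]) / 2
  have hK : ∀ m, |cov[W n, X m; P]| ≤ K := fun m => by
    have := abs_covariance_le hWn (hX2 m)
    rwa [hvar m] at this
  have himp := tendsto_impulse hroot
  have hbound : ∀ N : ℕ, |cov[W n, X j; P]|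
      ≤ |impulse a₁ a₂ (N + 1)| * K + |a₂ * impulse a₁ a₂ N| * K := by
    intro N
    have h := eq_sum_impulse_mul_add (x := fun k => cov[W n, X k; P])
      (u := fun k => cov[W n, W k; P] + θ * cov[W n, W (k - 1); P])
      (fun k => hX.covariance_recursion hX2 hWn k) N (j - N - 2)
    have hz : ∑ k ∈ Finset.range (N + 1), impulse a₁ a₂ k *
        (cov[W n, W (j - N - 2 + N + 2 - k); P]
          + θ * cov[W n, W (j - N - 2 + N + 2 - k - 1); P]) = 0 := by
      refine Finset.sum_eq_zero fun k _ => ?_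
      rw [hX.noise.covariance_of_ne (by omega), hX.noise.covariance_of_ne (by omega)]
      simp
    beta_reduce at h
    rw [hz, zero_add, show j - N - 2 + N + 2 = j by ring] at h
    rw [h]
    refine (abs_add_le _ _).trans ?_
    rw [abs_mul, abs_mul (a₂ * _)]
    exact add_le_add (mul_le_mul_of_nonneg_left (hK _) (abs_nonneg _))
      (mul_le_mul_of_nonneg_left (hK _) (abs_nonneg _))
  have hlim : Tendsto (fun N : ℕ => |impulse a₁ a₂ (N + 1)| * K + |a₂ * impulse a₁ a₂ N| * K)
      atTop (𝓝 0) := by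
    have := ((((tendsto_add_atTop_iff_nat 1).2 himp).abs).mul_const K).add
      (((himp.const_mul a₂).abs).mul_const K)
    simpa using this
  have := ge_of_tendsto' hlim hbound
  exact abs_eq_zero.1 (le_antisymm this (abs_nonneg _))

/-- The autocovariances of the process are the even extension of any sequence that solves the
Yule-Walker equations. -/
theorem covariance_eq (hX : IsARMASolution a₁ a₂ θ v X W P)
    (hroot : ∀ z : ℂ, ‖z‖ ≤ 1 → 1 - a₁ * z - a₂ * z ^ 2 ≠ 0) (ha₂ : 1 + a₂ ≠ 0) {c : ℕ → ℝ}
    (hc₀ : c 0 - a₁ * c 1 - a₂ * c 2 = v * (1 + θ ^ 2 + θ * a₁))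
    (hc₁ : c 1 - a₁ * c 0 - a₂ * c 1 = v * θ)
    (hc : ∀ n, c (n + 2) = a₁ * c (n + 1) + a₂ * c n) (i j : ℤ) :
    cov[X i, X j; P] = c (i - j).natAbs := by
  have hX2 : ∀ n, MemLp (X n) 2 P := fun n =>
    ((hX.isCenteredGaussianProcess hroot).eval n).memLp_two
  have hpast := fun {n j : ℤ} (h : j < n) => hX.covariance_noise_past hroot h
  have hshift : ∀ i j : ℤ, cov[X i, X j; P] = cov[X 0, X (j - i); P] := fun i j => by
    have := hX.stationary.covariance_add 0 (j - i) i
    rwa [zero_add, sub_add_cancel] at this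
  have heven : ∀ k : ℤ, cov[X 0, X (-k); P] = cov[X 0, X k; P] := fun k => by
    rw [covariance_comm, hshift, zero_sub, neg_neg]
  have hrec := fun k : ℤ => hX.covariance_recursion hX2 (hX2 0) k
  have hpast' : ∀ {n j : ℤ}, j < n → cov[X j, W n; P] = 0 := fun {n j} h => by
    rw [covariance_comm, hpast h]
  -- The right hand sides of the Yule-Walker equations come from these two covariances.
  have hself : cov[X 0, W 0; P] = v := by
    have := hX.covariance_recursion hX2 (hX.noise.memLp 0) 0
    rw [hpast (show (0 : ℤ) - 1 < 0 by norm_num), hpast (show (0 : ℤ) - 2 < 0 by norm_num),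
      hX.noise.covariance_self, hX.noise.covariance_of_ne (show (0 : ℤ) ≠ 0 - 1 by norm_num)]
      at this
    rw [covariance_comm]; linarith
  have hone : cov[X 0, W (-1); P] = v * (a₁ + θ) := by
    have h1 := hX.covariance_recursion hX2 (hX.noise.memLp (-1)) (-1)
    have h2 := hX.covariance_recursion hX2 (hX.noise.memLp (-1)) 0
    rw [hpast (show (-1 : ℤ) - 1 < -1 by norm_num), hpast (show (-1 : ℤ) - 2 < -1 by norm_num),
      hX.noise.covariance_self, hX.noise.covariance_of_ne (show (-1 : ℤ) ≠ -1 - 1 by norm_num)]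
      at h1
    rw [zero_sub, zero_sub, hpast (show (-2 : ℤ) < -1 by norm_num),
      hX.noise.covariance_of_ne (show (-1 : ℤ) ≠ 0 by norm_num), hX.noise.covariance_self] at h2
    rw [covariance_comm]
    linear_combination h2 + a₁ * h1
  have hg : (fun n : ℕ => cov[X 0, X n; P]) = c := by
    refine eq_of_yuleWalker ?_ ?_ ha₂ hc₀ hc₁ hc ?_ ?_ ?_
    · have := hroot 1 (by simp)
      intro h0
      apply this
      have : ((1 - a₁ - a₂ : ℝ) : ℂ) = 0 := by rw [h0]; simp
      push_cast at this
      linear_combination this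
    · have := hroot (-1) (by simp)
      intro h0
      apply this
      have : ((1 + a₁ - a₂ : ℝ) : ℂ) = 0 := by rw [h0]; simp
      push_cast at this
      linear_combination this
    · have := hrec 0
      rw [zero_sub, zero_sub, heven, heven, hself, hone] at this
      push_cast
      linear_combination this
    · have := hrec 1
      rw [sub_self, show (1 : ℤ) - 2 = -1 by norm_num, heven, hself, hpast' (by norm_num)] at this
      push_cast
      linear_combination this
    · intro n
      have := hrec (n + 2)
      rw [hpast' (by omega), hpast' (by omega), show (n : ℤ) + 2 - 1 = n + 1 by ring,
        show (n : ℤ) + 2 - 2 = n by ring] at this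
      push_cast
      linear_combination this
  have hg' : ∀ n : ℕ, cov[X 0, X n; P] = c n := fun n => congrFun hg n
  rw [hshift, ← hg']
  rcases Int.natAbs_eq (i - j) with h | h
  · rw [show j - i = -(i - j) by ring, heven, ← h]
  · rw [show j - i = ((i - j).natAbs : ℤ) by linarith]

end IsARMASolution

/-! ### Existence of the ARMA(2,1) process -/

section Existence

variable {a₁ a₂ θ : ℝ} {v : ℝ≥0}

/-- The space of noise realizations: sequences indexed by `ℤ` with i.i.d. `N(0, v)` entries. -/
noncomputable def noiseMeasure (v : ℝ≥0) : Measure (ℤ → ℝ) :=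
  Measure.infinitePi fun _ => gaussianReal 0 v

instance : IsProbabilityMeasure (noiseMeasure v) := by
  unfold noiseMeasure; infer_instance

theorem isGaussianNoise_eval (v : ℝ≥0) :
    IsGaussianNoise v (fun (n : ℤ) (ω : ℤ → ℝ) => ω n) (noiseMeasure v) where
  indep := iIndepFun_infinitePi (X := fun _ x => x) fun _ => measurable_id
  law n := (measurePreserving_eval_infinitePi (fun _ : ℤ => gaussianReal 0 v) n).hasLaw

theorem measurePreserving_shift (v : ℝ≥0) (s : ℤ) :
    MeasurePreserving (fun (ω : ℤ → ℝ) n => ω (n + s)) (noiseMeasure v) (noiseMeasure v) := by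
  have h := (isGaussianNoise_eval v).shift s
  have hm : ∀ n : ℤ, Measurable fun ω : ℤ → ℝ => ω (n + s) := fun n => measurable_pi_apply _
  refine ⟨measurable_pi_lambda _ hm, ?_⟩
  rw [(iIndepFun_iff_map_fun_eq_infinitePi_map hm).1 h.indep]
  simp only [(h.law _).map_eq]
  rfl

/-- The causal moving average `∑ hₖ (ω_{n-k} + θ ω_{n-k-1})`, with `h` the impulse response. -/
noncomputable def armaSeries (a₁ a₂ θ : ℝ) (n : ℤ) (ω : ℤ → ℝ) : ℝ :=
  ∑' k : ℕ, impulse a₁ a₂ k * (ω (n - k) + θ * ω (n - k - 1))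

theorem ae_summable_armaSeries
    (hroot : ∀ z : ℂ, ‖z‖ ≤ 1 → 1 - a₁ * z - a₂ * z ^ 2 ≠ 0) : ∀ᵐ ω ∂noiseMeasure v, ∀ n : ℤ,
      Summable fun k : ℕ => impulse a₁ a₂ k * (ω (n - k) + θ * ω (n - k - 1)) := by
  have hW := isGaussianNoise_eval v
  set C := ∫⁻ z, ‖z‖ₑ ∂gaussianReal 0 v with hC
  have hCtop : C ≠ ⊤ := (IsGaussian.integrable_id (μ := gaussianReal 0 v)).2.ne
  have hlin : ∀ m : ℤ, ∫⁻ ω, ‖ω m‖ₑ ∂noiseMeasure v = C := fun m =>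
    (hW.law m).lintegral_comp (by fun_prop)
  have key : ∀ᵐ ω ∂noiseMeasure v, ∀ n : ℤ,
      Summable fun k : ℕ => ‖impulse a₁ a₂ k * ω (n - k)‖ := by
    rw [ae_all_iff]
    intro n
    have hmeas : ∀ k : ℕ, AEMeasurable (fun ω : ℤ → ℝ => ‖impulse a₁ a₂ k * ω (n - k)‖ₑ)
        (noiseMeasure v) := fun k =>
      ((measurable_pi_apply _).const_mul _).enorm.aemeasurable
    have hfin : ∫⁻ ω, ∑' k : ℕ, ‖impulse a₁ a₂ k * ω (n - k)‖ₑ ∂noiseMeasure v ≠ ⊤ := by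
      rw [lintegral_tsum hmeas]
      have : ∀ k : ℕ, ∫⁻ ω, ‖impulse a₁ a₂ k * ω (n - k)‖ₑ ∂noiseMeasure v
          = ‖impulse a₁ a₂ k‖ₑ * C := fun k => by
        simp_rw [enorm_mul]
        rw [lintegral_const_mul _ (by fun_prop), hlin]
      simp_rw [this]
      rw [ENNReal.tsum_mul_right]
      refine ENNReal.mul_ne_top ?_ hCtop
      exact tsum_enorm_ne_top_iff_summable_norm.2 (by simpa using summable_abs_impulse hroot)
    filter_upwards [ae_lt_top' (AEMeasurable.tsum hmeas) hfin] with ω hω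
    exact tsum_enorm_ne_top_iff_summable_norm.1 hω.ne
  filter_upwards [key] with ω hω n
  have h1 := (hω n).of_norm
  have h2 := ((hω (n - 1)).of_norm).mul_left θ
  refine (h1.add h2).congr fun k => ?_
  rw [show n - 1 - (k : ℤ) = n - k - 1 by ring]; ring

/-- The causal moving average solves the ARMA(2,1) recursion, and it is stationary because it
commutes with the measure preserving shift of the noise. -/
theorem isARMASolution_armaSeries
    (hroot : ∀ z : ℂ, ‖z‖ ≤ 1 → 1 - a₁ * z - a₂ * z ^ 2 ≠ 0) :
    IsARMASolution a₁ a₂ θ v (armaSeries a₁ a₂ θ) (fun n ω => ω n) (noiseMeasure v) where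
  noise := isGaussianNoise_eval v
  stationary := by
    have hmeas : ∀ t : ℤ, AEMeasurable (armaSeries a₁ a₂ θ t) (noiseMeasure v) := fun t => by
      refine aemeasurable_of_tendsto_metrizable_ae atTop (f := fun N (ω : ℤ → ℝ) =>
        ∑ k ∈ Finset.range N, impulse a₁ a₂ k * (ω (t - k) + θ * ω (t - k - 1)))
        (fun N => by fun_prop) ?_
      filter_upwards [ae_summable_armaSeries (θ := θ) hroot] with ω hω
      exact (hω t).hasSum.tendsto_sum_nat
    intro I s
    have hcomp : (fun (ω : ℤ → ℝ) (t : I) => armaSeries a₁ a₂ θ (t + s) ω)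
        = (fun (ω : ℤ → ℝ) (t : I) => armaSeries a₁ a₂ θ t ω) ∘ fun ω n => ω (n + s) := by
      ext ω t
      simp only [armaSeries, Function.comp]
      refine tsum_congr fun k => ?_
      rw [show (t : ℤ) + s - k = t - k + s by ring,
        show (t : ℤ) - k + s - 1 = t - k - 1 + s by ring]
    have hI : AEMeasurable (fun (ω : ℤ → ℝ) (t : I) => armaSeries a₁ a₂ θ t ω) (noiseMeasure v) :=
      aemeasurable_pi_lambda _ fun t => hmeas t
    have hmp := measurePreserving_shift v s
    rw [hcomp]
    refine ⟨hI.comp_quasiMeasurePreserving hmp.quasiMeasurePreserving, hI, ?_⟩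
    rw [← AEMeasurable.map_map_of_aemeasurable (by rwa [hmp.map_eq]) hmp.aemeasurable, hmp.map_eq]
  recursion := by
    filter_upwards [ae_summable_armaSeries (θ := θ) hroot] with ω hω n
    have h0 := (hω n).sum_add_tsum_nat_add 2
    have h1 := (hω (n - 1)).sum_add_tsum_nat_add 1
    have hs : ∑' k : ℕ, impulse a₁ a₂ (k + 2)
        * (ω (n - (k + 2 : ℕ)) + θ * ω (n - (k + 2 : ℕ) - 1))
        = a₁ * (∑' k : ℕ, impulse a₁ a₂ (k + 1)
            * (ω (n - 1 - (k + 1 : ℕ)) + θ * ω (n - 1 - (k + 1 : ℕ) - 1)))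
          + a₂ * armaSeries a₁ a₂ θ (n - 2) ω := by
      rw [armaSeries, ← tsum_mul_left, ← tsum_mul_left, ← Summable.tsum_add]
      · refine tsum_congr fun k => ?_
        rw [impulse_add_two, show n - 1 - ((k + 1 : ℕ) : ℤ) = n - 2 - k by push_cast; ring,
          show n - ((k + 2 : ℕ) : ℤ) = n - 2 - k by push_cast; ring]
        ring
      · exact ((summable_nat_add_iff 1).2 (hω (n - 1))).mul_left a₁
      · exact (hω (n - 2)).mul_left a₂
    have e0 : armaSeries a₁ a₂ θ n ω = _ := h0.symm
    have e1 : armaSeries a₁ a₂ θ (n - 1) ω = _ := h1.symm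
    rw [hs] at e0
    rw [e0, e1]
    simp only [Finset.sum_range_succ, Finset.sum_range_zero, impulse]
    push_cast
    simp only [sub_zero]
    ring

end Existence

/-! ### The lag operator and the law of an ARMA process -/

section Lag

/-- The lag operator `(L s)ₙ = sₙ₋₁` on sequences indexed by `ℤ`. For a polynomial `f`,
`aeval lag f` is the filter with coefficients `f`, and products of polynomials are compositions of
filters. -/
def lag : Module.End ℝ (ℤ → ℝ) := LinearMap.funLeft ℝ ℝ fun n => n - 1

theorem lag_pow_apply (k : ℕ) (s : ℤ → ℝ) (n : ℤ) : (lag ^ k) s n = s (n - k) := by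
  induction k generalizing n with
  | zero => simp
  | succ k ih =>
    rw [pow_succ', Module.End.mul_apply]
    change (lag ^ k) s (n - 1) = _
    rw [ih]
    congr 1
    push_cast; ring

theorem aeval_lag_apply {f : Polynomial ℝ} {N : ℕ} (hN : f.natDegree < N) (s : ℤ → ℝ) (n : ℤ) :
    Polynomial.aeval lag f s n = ∑ k ∈ Finset.range N, f.coeff k * s (n - k) := by
  rw [Polynomial.aeval_eq_sum_range' hN]
  simp [LinearMap.sum_apply, Finset.sum_apply, lag_pow_apply]

theorem aeval_lag_arPoly {p : ℕ} (φ : Fin p → ℝ) (s : ℤ → ℝ) (n : ℤ) :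
    Polynomial.aeval lag (arPoly φ) s n = s n - ∑ i : Fin p, φ i * s (n - ((i : ℤ) + 1)) := by
  simp [arPoly, map_sub, map_sum, Polynomial.aeval_C, LinearMap.sum_apply, Finset.sum_apply,
    Algebra.algebraMap_eq_smul_one, lag_pow_apply]

theorem aeval_lag_maPoly {q : ℕ} (θ : Fin q → ℝ) (s : ℤ → ℝ) (n : ℤ) :
    Polynomial.aeval lag (maPoly θ) s n = s n + ∑ i : Fin q, θ i * s (n - ((i : ℤ) + 1)) := by
  simp [maPoly, map_add, map_sum, Polynomial.aeval_C, LinearMap.sum_apply, Finset.sum_apply,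
    Algebra.algebraMap_eq_smul_one, lag_pow_apply]

variable {Ω : Type*} [MeasurableSpace Ω] {P : Measure Ω}

theorem covariance_aeval_lag [IsFiniteMeasure P] {X : ℤ → Ω → ℝ} (hX : ∀ n, MemLp (X n) 2 P)
    {f g : Polynomial ℝ} {N M : ℕ} (hf : f.natDegree < N) (hg : g.natDegree < M) (n m : ℤ) :
    cov[fun ω => Polynomial.aeval lag f (fun k => X k ω) n,
      fun ω => Polynomial.aeval lag g (fun k => X k ω) m; P]
      = ∑ i ∈ Finset.range N, ∑ j ∈ Finset.range M,
        f.coeff i * g.coeff j * cov[X (n - i), X (m - j); P] := by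
  simp_rw [aeval_lag_apply hf, aeval_lag_apply hg]
  rw [covariance_fun_sum_fun_sum' (fun _ _ => (hX _).const_mul _) fun _ _ => (hX _).const_mul _]
  refine Finset.sum_congr rfl fun i _ => Finset.sum_congr rfl fun j _ => ?_
  rw [covariance_const_mul_left, covariance_const_mul_right, mul_assoc]

theorem reflect_eq_sum {f : Polynomial ℝ} {N : ℕ} (hf : f.natDegree ≤ N) :
    f.reflect N = ∑ i ∈ Finset.range (N + 1),
      Polynomial.C (f.coeff i) * Polynomial.X ^ (N - i) := by
  ext n
  simp only [Polynomial.coeff_reflect, Polynomial.finsetSum_coeff, Polynomial.coeff_C_mul_X_pow]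
  rcases le_or_gt n N with h | h
  · rw [Polynomial.revAt_le h, Finset.sum_eq_single (N - n)]
    · rw [if_pos (by omega)]
    · intro b hb hne
      rw [Finset.mem_range] at hb
      rw [if_neg (by omega)]
    · intro hn
      exact absurd (Finset.mem_range.2 (by omega)) hn
  · rw [Polynomial.revAt_eq_self_of_lt h,
      Polynomial.coeff_eq_zero_of_natDegree_lt (lt_of_le_of_lt hf h)]
    exact (Finset.sum_eq_zero fun i _ => if_neg (by omega)).symm

/-- The autocovariances of a filtered noise are the coefficients of `f(1/z) g(z)`; the power of `z`
that makes this a polynomial appears as a shift of the time. -/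
theorem IsGaussianNoise.covariance_aeval_lag [IsProbabilityMeasure P] {v : ℝ≥0}
    {W : ℤ → Ω → ℝ} (hW : IsGaussianNoise v W P) {f : Polynomial ℝ} {N : ℕ}
    (hf : f.natDegree ≤ N) (g : Polynomial ℝ) (k : ℕ) :
    cov[fun ω => Polynomial.aeval lag f (fun k => W k ω) N,
      fun ω => Polynomial.aeval lag g (fun k => W k ω) k; P] = v * (f.reflect N * g).coeff k := by
  rw [_root_.covariance_aeval_lag hW.memLp (Nat.lt_succ_of_le hf) (Nat.lt_succ_self _)]
  conv_rhs => rw [reflect_eq_sum hf, g.as_sum_range_C_mul_X_pow, Finset.sum_mul_sum]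
  simp_rw [Polynomial.finsetSum_coeff, Finset.mul_sum]
  refine Finset.sum_congr rfl fun i hi => Finset.sum_congr rfl fun j hj => ?_
  rw [Finset.mem_range] at hi
  have e : Polynomial.C (f.coeff i) * Polynomial.X ^ (N - i)
      * (Polynomial.C (g.coeff j) * Polynomial.X ^ j)
      = Polynomial.C (f.coeff i * g.coeff j) * Polynomial.X ^ (N - i + j) := by
    rw [Polynomial.C_mul, pow_add]; ring
  rw [e, Polynomial.coeff_C_mul_X_pow]
  split_ifs with h
  · rw [show (k : ℤ) - j = N - i by omega, hW.covariance_self]; ring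
  · rw [hW.covariance_of_ne (by omega)]; ring

/-- If `f` has no zero in the closed unit disc, then `z ^ N f(1/z)` has no zero outside of it. -/
theorem aeval_reflect_ne_zero {f : Polynomial ℝ} {N : ℕ} (hN : f.natDegree ≤ N)
    (hf : ∀ z : ℂ, ‖z‖ ≤ 1 → Polynomial.aeval z f ≠ 0) {z : ℂ} (hz : 1 < ‖z‖) :
    Polynomial.aeval z (f.reflect N) ≠ 0 := by
  have hz0 : z ≠ 0 := by rintro rfl; simp at hz; linarith
  let _ : Invertible z⁻¹ := invertibleOfNonzero (inv_ne_zero hz0)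
  have h := Polynomial.eval₂_reflect_eq_zero_iff (algebraMap ℝ ℂ) z⁻¹ N f hN
  rw [invOf_eq_inv, inv_inv] at h
  rw [Polynomial.aeval_def, Ne, h]
  exact hf _ (by rw [norm_inv]; exact inv_le_one_of_one_le₀ hz.le)

theorem dvd_of_reflect_mul_eq {f g : Polynomial ℝ} {N : ℕ} (hg : g.natDegree ≤ N) {u v : ℝ}
    (hv : v ≠ 0) (hfz : ∀ z : ℂ, ‖z‖ ≤ 1 → Polynomial.aeval z f ≠ 0)
    (hgz : ∀ z : ℂ, ‖z‖ ≤ 1 → Polynomial.aeval z g ≠ 0)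
    (h : Polynomial.C u * (f.reflect N * f) = Polynomial.C v * (g.reflect N * g)) : f ∣ g := by
  have hcop : IsCoprime f (g.reflect N) := by
    rw [Polynomial.isCoprime_iff_aeval_ne_zero_of_isAlgClosed ℝ ℂ]
    intro z
    rcases le_or_gt ‖z‖ 1 with hz | hz
    · exact Or.inl (hfz z hz)
    · exact Or.inr (aeval_reflect_ne_zero hg hgz hz)
  refine hcop.dvd_of_dvd_mul_left ?_
  have : g.reflect N * g = f * (Polynomial.C (v⁻¹ * u) * f.reflect N) := by
    calc g.reflect N * g = Polynomial.C v⁻¹ * (Polynomial.C v * (g.reflect N * g)) := by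
          rw [← mul_assoc, ← Polynomial.C_mul, inv_mul_cancel₀ hv, Polynomial.C_1, one_mul]
      _ = _ := by rw [← h, Polynomial.C_mul]; ring
  exact ⟨_, this⟩

theorem eq_of_dvd_of_dvd_of_coeff_zero {f g : Polynomial ℝ} (hfg : f ∣ g) (hgf : g ∣ f)
    (hf : f.coeff 0 = 1) (hg : g.coeff 0 = 1) : f = g := by
  obtain ⟨u, hu⟩ := associated_of_dvd_dvd hfg hgf
  obtain ⟨r, -, hr⟩ := Polynomial.isUnit_iff.1 u.isUnit
  rw [← hr] at hu
  have : r = 1 := by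
    have := congrArg (fun p => Polynomial.coeff p 0) hu
    simpa [hf, hg] using this
  simpa [this] using hu

/-- Spectral factorization is unique: a polynomial without zeros in the closed unit disc is
determined, up to a constant, by the product `f(1/z) f(z)`. -/
theorem eq_of_reflect_mul_eq {f g : Polynomial ℝ} {N : ℕ} (hfN : f.natDegree ≤ N)
    (hgN : g.natDegree ≤ N) {u v : ℝ} (hv : v ≠ 0)
    (hfz : ∀ z : ℂ, ‖z‖ ≤ 1 → Polynomial.aeval z f ≠ 0)
    (hgz : ∀ z : ℂ, ‖z‖ ≤ 1 → Polynomial.aeval z g ≠ 0) (hf : f.coeff 0 = 1) (hg : g.coeff 0 = 1)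
    (h : Polynomial.C u * (f.reflect N * f) = Polynomial.C v * (g.reflect N * g)) :
    f = g ∧ u = v := by
  have hne : ∀ p : Polynomial ℝ, p.coeff 0 = 1 → p.reflect N * p ≠ 0 := fun p hp => by
    have : p ≠ 0 := by rintro rfl; simp at hp
    exact mul_ne_zero (by rwa [Ne, Polynomial.reflect_eq_zero_iff]) this
  have hu : u ≠ 0 := by
    rintro rfl
    rw [Polynomial.C_0, zero_mul, eq_comm, mul_eq_zero, Polynomial.C_eq_zero] at h
    exact h.elim hv (hne g hg)
  have hfg : f = g := eq_of_dvd_of_dvd_of_coeff_zero (dvd_of_reflect_mul_eq hgN hv hfz hgz h)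
    (dvd_of_reflect_mul_eq hfN hu hgz hfz h.symm) hf hg
  subst hfg
  exact ⟨rfl, Polynomial.C_injective (mul_right_cancel₀ (hne f hf) h)⟩

end Lag

theorem arPoly_coeff_zero {p : ℕ} (φ : Fin p → ℝ) : (arPoly φ).coeff 0 = 1 := by
  simp [arPoly]

theorem maPoly_coeff_zero {q : ℕ} (θ : Fin q → ℝ) : (maPoly θ).coeff 0 = 1 := by
  simp [maPoly]

namespace IsARMA

variable {Ω : Type*} [MeasurableSpace Ω] {P : Measure Ω}
  {p q : ℕ} {φ : Fin p → ℝ} {θ : Fin q → ℝ} {w : ℝ≥0} {X : ℤ → Ω → ℝ}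

theorem exists_aeval_lag_eq (hX : IsARMA φ θ w X P) : ∃ W : ℤ → Ω → ℝ, IsGaussianNoise w W P ∧
    ∀ᵐ ω ∂P, Polynomial.aeval lag (arPoly φ) (fun n => X n ω)
      = Polynomial.aeval lag (maPoly θ) (fun n => W n ω) := by
  obtain ⟨W, hW, h⟩ := hX.recursion
  refine ⟨W, hW, ?_⟩
  filter_upwards [ae_all_iff.2 h] with ω hω
  ext n
  rw [aeval_lag_arPoly, aeval_lag_maPoly, hω n]

variable [IsProbabilityMeasure P]

/-- Applying an additional filter `f` to an ARMA process makes it a filtered noise when `f` is a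
multiple of the autoregressive polynomial. -/
theorem covariance_aeval_lag_mul (hX : IsARMA φ θ w X P) (f : Polynomial ℝ) {N : ℕ}
    (hN : (f * maPoly θ).natDegree ≤ N) (k : ℕ) :
    cov[fun ω => Polynomial.aeval lag (f * arPoly φ) (fun k => X k ω) N,
      fun ω => Polynomial.aeval lag (f * arPoly φ) (fun k => X k ω) k; P]
      = w * ((f * maPoly θ).reflect N * (f * maPoly θ)).coeff k := by
  obtain ⟨W, hW, h⟩ := hX.exists_aeval_lag_eq
  rw [← hW.covariance_aeval_lag hN]
  have h' : ∀ n, (fun ω => Polynomial.aeval lag (f * arPoly φ) (fun k => X k ω) n)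
      =ᵐ[P] fun ω => Polynomial.aeval lag (f * maPoly θ) (fun k => W k ω) n := fun n => by
    filter_upwards [h] with ω hω
    rw [map_mul, map_mul, Module.End.mul_apply, Module.End.mul_apply, hω]
  exact covariance_congr_ae (h' _) (h' _)

/-- A causal invertible ARMA model is determined by its autocovariances. Filtering two processes
with the same autocovariances by the product of their autoregressive polynomials gives two moving
averages with the same autocovariances, and spectral factorization is unique. -/
theorem eq_of_covariance_eq (hX : IsARMA φ θ w X P) (hφ : IsCausal φ) (hθ : IsInvertibleMA θ)
    {Ω' : Type*} [MeasurableSpace Ω'] {P' : Measure Ω'} [IsProbabilityMeasure P']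
    {p' q' : ℕ} {φ' : Fin p' → ℝ} {θ' : Fin q' → ℝ} {v : ℝ≥0} {Z : ℤ → Ω' → ℝ}
    (hZ : IsARMA φ' θ' v Z P') (hφ' : IsCausal φ') (hθ' : IsInvertibleMA θ') (hv : v ≠ 0)
    (hX2 : ∀ n, MemLp (X n) 2 P) (hZ2 : ∀ n, MemLp (Z n) 2 P')
    (hcov : ∀ i j, cov[X i, X j; P] = cov[Z i, Z j; P']) :
    w = v ∧ arPoly φ = arPoly φ' ∧ maPoly θ = maPoly θ' := by
  set F := arPoly φ' * maPoly θ
  set G := arPoly φ * maPoly θ'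
  obtain ⟨N, hF, hG⟩ : ∃ N, F.natDegree ≤ N ∧ G.natDegree ≤ N :=
    ⟨max F.natDegree G.natDegree, le_max_left _ _, le_max_right _ _⟩
  have h : Polynomial.C (w : ℝ) * (F.reflect N * F) = Polynomial.C (v : ℝ) * (G.reflect N * G) := by
    ext k
    rw [Polynomial.coeff_C_mul, Polynomial.coeff_C_mul,
      ← hX.covariance_aeval_lag_mul (arPoly φ') hF k,
      ← hZ.covariance_aeval_lag_mul (arPoly φ) hG k, mul_comm (arPoly φ'),
      covariance_aeval_lag hX2 (Nat.lt_succ_self _) (Nat.lt_succ_self _),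
      covariance_aeval_lag hZ2 (Nat.lt_succ_self _) (Nat.lt_succ_self _)]
    simp_rw [hcov]
  have hFz : ∀ z : ℂ, ‖z‖ ≤ 1 → Polynomial.aeval z F ≠ 0 := fun z hz => by
    rw [map_mul]; exact mul_ne_zero (hφ' z hz) (hθ z hz)
  have hGz : ∀ z : ℂ, ‖z‖ ≤ 1 → Polynomial.aeval z G ≠ 0 := fun z hz => by
    rw [map_mul]; exact mul_ne_zero (hφ z hz) (hθ' z hz)
  obtain ⟨hFG, hwv⟩ := eq_of_reflect_mul_eq hF hG (by exact_mod_cast hv) hFz hGz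
    (by simp [F, Polynomial.mul_coeff_zero, arPoly_coeff_zero, maPoly_coeff_zero])
    (by simp [G, Polynomial.mul_coeff_zero, arPoly_coeff_zero, maPoly_coeff_zero]) h
  have hφφ' : arPoly φ = arPoly φ' := by
    refine eq_of_dvd_of_dvd_of_coeff_zero
      (hX.coprime.dvd_of_dvd_mul_right (Dvd.intro _ hFG.symm))
      (hZ.coprime.dvd_of_dvd_mul_right (Dvd.intro _ hFG)) (arPoly_coeff_zero _)
      (arPoly_coeff_zero _)
  refine ⟨by exact_mod_cast hwv, hφφ', ?_⟩
  have hne : arPoly φ' ≠ 0 := fun h0 => by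
    have := arPoly_coeff_zero φ'
    rw [h0] at this; simp at this
  simp only [F, G, hφφ'] at hFG
  exact mul_left_cancel₀ hne hFG

/-- A causal ARMA process with constant mean is centred: taking expectations in the recursion gives
`φ(1) μ = 0`. -/
theorem integral_eq_zero (hX : IsARMA φ θ w X P) (hφ : IsCausal φ)
    (hXi : ∀ n, Integrable (X n) P) {μ : ℝ} (hμ : ∀ n, ∫ ω, X n ω ∂P = μ) : μ = 0 := by
  obtain ⟨W, hW, h⟩ := hX.exists_aeval_lag_eq
  have hint : ∀ (f : Polynomial ℝ) {Y : ℤ → Ω → ℝ} {r : ℝ}, (∀ n, Integrable (Y n) P) →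
      (∀ n, ∫ ω, Y n ω ∂P = r) →
      ∫ ω, Polynomial.aeval lag f (fun n => Y n ω) 0 ∂P = f.eval 1 * r := by
    intro f Y r hY hr
    simp_rw [aeval_lag_apply (Nat.lt_succ_self f.natDegree)]
    rw [integral_finsetSum _ fun k _ => (hY _).const_mul _]
    simp_rw [integral_const_mul, hr]
    rw [← Finset.sum_mul, Polynomial.eval_eq_sum_range]
    simp
  have e : ∫ ω, Polynomial.aeval lag (arPoly φ) (fun n => X n ω) 0 ∂P
      = ∫ ω, Polynomial.aeval lag (maPoly θ) (fun n => W n ω) 0 ∂P :=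
    integral_congr_ae (by filter_upwards [h] with ω hω; rw [hω])
  rw [hint _ hXi hμ, hint _ (fun n => (hW.memLp n).integrable one_le_two)
    fun n => (hW.isCenteredGaussianProcess.eval n).integral_eq_zero, mul_zero] at e
  refine (mul_eq_zero.1 e).resolve_left fun h0 => hφ 1 (by simp) ?_
  have := Polynomial.aeval_algebraMap_apply ℂ (1 : ℝ) (arPoly φ)
  rw [map_one] at this
  rw [this, Polynomial.coe_aeval_eq_eval, h0, map_zero]

end IsARMA

namespace IsARMASolution

variable {Ω : Type*} [MeasurableSpace Ω] {P : Measure Ω} {a₁ a₂ θ : ℝ} {v : ℝ≥0}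
  {X W : ℤ → Ω → ℝ}

theorem isARMA (hX : IsARMASolution a₁ a₂ θ v X W P)
    (hcop : IsCoprime (arPoly ![a₁, a₂]) (maPoly ![θ])) : IsARMA ![a₁, a₂] ![θ] v X P where
  stationary := hX.stationary
  recursion := by
    refine ⟨W, hX.noise, fun n => ?_⟩
    filter_upwards [hX.recursion] with ω hω
    have := hω n
    simp only [Fin.sum_univ_two, Matrix.cons_val_zero, Matrix.cons_val_one,
      Finset.univ_unique, Finset.sum_singleton, Fin.default_eq_zero, Fin.val_zero, Fin.val_one]
    norm_num
    linarith
  coprime := hcop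

theorem of_isARMA {p q : ℕ} {φ : Fin p → ℝ} {η : Fin q → ℝ} (hX : IsARMA φ η v X P)
    (hφ : arPoly φ = 1 - Polynomial.C a₁ * Polynomial.X - Polynomial.C a₂ * Polynomial.X ^ 2)
    (hη : maPoly η = 1 + Polynomial.C θ * Polynomial.X) :
    ∃ W, IsARMASolution a₁ a₂ θ v X W P := by
  obtain ⟨W, hW, h⟩ := hX.exists_aeval_lag_eq
  refine ⟨W, hX.stationary, hW, ?_⟩
  filter_upwards [h] with ω hω n
  rw [hφ, hη, ← arPoly_two, ← maPoly_one] at hω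
  have := congrFun hω n
  rw [aeval_lag_arPoly, aeval_lag_maPoly] at this
  simp only [Fin.sum_univ_two, Matrix.cons_val_zero, Matrix.cons_val_one,
    Finset.univ_unique, Finset.sum_singleton, Fin.default_eq_zero, Fin.val_zero, Fin.val_one]
    at this
  norm_num at this
  linarith

end IsARMASolution

/-! ### Comparison of the sampled process with ARMA processes -/

section SampledProcess

variable {Ω : Type*} [MeasurableSpace Ω] {P : Measure Ω} {γ α σ : ℝ}
  {x y B : ℝ≥0 → Ω → ℝ} {h : ℝ≥0}
  {Ω' : Type*} [MeasurableSpace Ω'] {P' : Measure Ω'}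

/-- Equality of laws along `n ≥ 0` passes to the whole stationary process. -/
theorem SameLawAsSamples.memLp_and_covariance {X : ℤ → Ω' → ℝ}
    (hlaw : SameLawAsSamples X P' x h P) (hX : IsStrictlyStationary X P')
    (hx : ∀ t, MemLp (x t) 2 P) :
    (∀ n, MemLp (X n) 2 P') ∧ ∀ i j, cov[X i, X j; P'] = sampledAutocov x h P (i - j).natAbs := by
  have heval : ∀ n : ℕ, IdentDistrib (X n) (x (n * h)) P' P := fun n =>
    hlaw.comp (u := fun f : ℕ → ℝ => f n) (measurable_pi_apply n)
  have hle : ∀ (i : ℤ) (k : ℕ), cov[X i, X (i + k); P'] = sampledAutocov x h P k := fun i k => by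
    have h1 := hX.covariance_add 0 k i
    rw [zero_add, add_comm] at h1
    rw [h1]
    have h2 := covariance_eq_of_identDistrib hlaw (measurable_pi_apply 0) (measurable_pi_apply k)
    simpa [sampledAutocov] using h2
  refine ⟨fun n => ?_, fun i j => ?_⟩
  · have h1 := (hX.identDistrib_comp n (fun _ : Unit => (0 : ℤ))).comp
      (u := fun f : Unit → ℝ => f ()) (measurable_pi_apply ())
    have h1 : IdentDistrib (X (0 + n)) (X 0) P' P' := h1
    rw [zero_add] at h1
    exact (h1.trans (heval 0)).symm.memLp_snd (hx _)
  · rcases le_total i j with hij | hij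
    · obtain ⟨k, rfl⟩ := Int.le.dest hij
      rw [hle]
      congr 1; omega
    · obtain ⟨k, rfl⟩ := Int.le.dest hij
      rw [covariance_comm, hle]
      congr 1; omega

variable [IsProbabilityMeasure P]

theorem IsStationaryLangevin.sampledAutocov_eq (hsol : IsStationaryLangevin γ α σ x y B P)
    (hγ : 0 < γ) (hα : 0 < α) (hh : 0 < h) (hq : flowQ γ α h ≠ 0) (j : ℕ) :
    sampledAutocov x h P j = σ ^ 2 / (2 * α * γ) * flowP γ α (j * h) := by
  rw [sampledAutocov, hsol.covariance_x hγ hα hh hq, hsol.variance_x hγ hα hh hq]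
  push_cast
  rfl

variable [IsProbabilityMeasure P']

/-- An ARMA(2,1) process whose Yule-Walker equations are solved by the autocovariances of the
samples has the law of the samples, as both processes are centred Gaussian. -/
theorem IsARMASolution.sameLawAsSamples {a₁ a₂ θ : ℝ} {v : ℝ≥0} {X W : ℤ → Ω' → ℝ}
    (hX : IsARMASolution a₁ a₂ θ v X W P') (hsol : IsStationaryLangevin γ α σ x y B P)
    (hγ : 0 < γ) (hα : 0 < α) (hh : 0 < h) (hq : flowQ γ α h ≠ 0)
    (hroot : ∀ z : ℂ, ‖z‖ ≤ 1 → 1 - a₁ * z - a₂ * z ^ 2 ≠ 0) (ha₂ : 1 + a₂ ≠ 0) {c : ℕ → ℝ}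
    (hc : ∀ j, c j = sampledAutocov x h P j)
    (hc₀ : c 0 - a₁ * c 1 - a₂ * c 2 = v * (1 + θ ^ 2 + θ * a₁))
    (hc₁ : c 1 - a₁ * c 0 - a₂ * c 1 = v * θ)
    (hrec : ∀ n, c (n + 2) = a₁ * c (n + 1) + a₂ * c n) : SameLawAsSamples X P' x h P := by
  refine ((hX.isCenteredGaussianProcess hroot).comp ((↑) : ℕ → ℤ)).identDistrib
    (hsol.isCenteredGaussianProcess_sampled hγ hα hh hq) fun i j => ?_
  rw [hX.covariance_eq hroot ha₂ hc₀ hc₁ hrec, hc]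
  rcases le_total i j with hij | hij
  · obtain ⟨k, rfl⟩ := Nat.exists_eq_add_of_le hij
    rw [hsol.covariance_sampled h i k]
    congr 1; omega
  · obtain ⟨k, rfl⟩ := Nat.exists_eq_add_of_le hij
    rw [covariance_comm, hsol.covariance_sampled h j k]
    congr 1; omega

/-- A process with constant shift `m` that has the law of the samples has zero mean. -/
theorem SameLawAsSamples.mean_eq_zero {X : ℤ → Ω' → ℝ}
    (hlaw : SameLawAsSamples X P' x h P) (hx : ∀ t, MemLp (x t) 2 P)
    (hx0 : ∫ ω, x 0 ω ∂P = 0) {p q : ℕ} {φ : Fin p → ℝ} {θ : Fin q → ℝ} {w : ℝ≥0} {m : ℝ}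
    (hX : IsARMA φ θ w (fun n ω => X n ω - m) P') (hφ : IsCausal φ) : m = 0 := by
  have h0 : IdentDistrib (X 0) (x 0) P' P := by
    have := hlaw.comp (u := fun f : ℕ → ℝ => f 0) (measurable_pi_apply 0)
    simpa [Function.comp_def] using this
  have hX0 : Integrable (X 0) P' := h0.integrable_iff.2 ((hx 0).integrable one_le_two)
  have hn : ∀ n : ℤ, IdentDistrib (fun ω => X n ω - m) (fun ω => X 0 ω - m) P' P' := fun n => by
    have := (hX.stationary.identDistrib_comp n (fun _ : Unit => (0 : ℤ))).comp
      (u := fun f : Unit → ℝ => f ()) (measurable_pi_apply ())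
    simpa [Function.comp_def] using this
  have := hX.integral_eq_zero hφ (μ := -m)
    (fun n => (hn n).integrable_iff.2 (hX0.sub (integrable_const m))) fun n => by
      rw [(hn n).integral_eq, integral_sub hX0 (integrable_const m), h0.integral_eq, hx0]
      simp
  linarith

end SampledProcess

theorem proposition1 {Ω : Type*} [MeasurableSpace Ω] (P : Measure Ω) [IsProbabilityMeasure P]
    (γ α σ : ℝ) (hγ : 0 < γ) (hα : 0 < α) (hσ : σ ≠ 0)
    (h : ℝ≥0) (hh : 0 < h) (h12 : langevinPropagator γ α h 0 1 ≠ 0)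
    (x y B : ℝ≥0 → Ω → ℝ) (hsol : IsStationaryLangevin γ α σ x y B P)
    (a₁ a₂ : ℝ) (ha₁ : a₁ = (langevinPropagator γ α h).trace) (ha₂ : a₂ = -Real.exp (-γ * h))
    (c : ℕ → ℝ) (hc : ∀ j, c j = sampledAutocov x h P j) :
    -- the autocovariances of the sampled process
    ((∀ k j : ℕ, cov[x ((k : ℝ≥0) * h), x (((k + j : ℕ) : ℝ≥0) * h); P] = c j) ∧
      c 0 = σ ^ 2 / (2 * α * γ) ∧
      (∀ l₁ l₂ : ℂ, l₁ ≠ l₂ → l₁ ^ 2 + γ * l₁ + α = 0 → l₂ ^ 2 + γ * l₂ + α = 0 →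
        ∀ j : ℕ, (c j : ℂ) = c 0 *
          ((l₁ * Complex.exp (l₂ * j * h) - l₂ * Complex.exp (l₁ * j * h)) / (l₁ - l₂))) ∧
      (γ ^ 2 - 4 * α = 0 →
        ∀ j : ℕ, c j = c 0 * (Real.exp (-γ / 2 * j * h) * (1 - -γ / 2 * j * h)))) ∧
    ∃ (θ₁ : ℝ) (v : ℝ≥0),
      |θ₁| < 1 ∧ 0 < v ∧
      -- the two equations for the moving average coefficient and the noise variance
      v * (1 + θ₁ ^ 2 + θ₁ * a₁) = c 0 - c 1 * a₁ - c 2 * a₂ ∧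
      v * θ₁ = c 1 * (1 - a₂) - c 0 * a₁ ∧
      -- which determine them
      (∀ θ' v' : ℝ, |θ'| < 1 →
        v' * (1 + θ' ^ 2 + θ' * a₁) = c 0 - c 1 * a₁ - c 2 * a₂ →
        v' * θ' = c 1 * (1 - a₂) - c 0 * a₁ → θ' = θ₁ ∧ v' = v) ∧
      -- there is a causal invertible ARMA(2,1) process with these parameters and the law of
      -- the sampled process
      IsCausal ![a₁, a₂] ∧ IsInvertibleMA ![θ₁] ∧
      (∃ (Ω' : Type) (_ : MeasurableSpace Ω') (P' : Measure Ω') (_ : IsProbabilityMeasure P')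
        (X W : ℤ → Ω' → ℝ),
        IsARMA ![a₁, a₂] ![θ₁] v X P' ∧ IsGaussianNoise v W P' ∧
        (∀ n : ℤ, ∀ᵐ ω ∂P',
          X (n + 2) ω = a₁ * X (n + 1) ω + a₂ * X n ω + W n ω + θ₁ * W (n - 1) ω) ∧
        SameLawAsSamples X P' x h P) ∧
      -- among all causal invertible ARMA processes, of any orders and any mean, exactly those
      -- with these parameters have the law of the sampled process
      (∀ (Ω' : Type*) [MeasurableSpace Ω'] (P' : Measure Ω') [IsProbabilityMeasure P']
        (p q : ℕ) (φ : Fin p → ℝ) (θ : Fin q → ℝ) (w : ℝ≥0) (m : ℝ) (X : ℤ → Ω' → ℝ),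
        IsARMA φ θ w (fun n ω => X n ω - m) P' → IsCausal φ → IsInvertibleMA θ →
        (SameLawAsSamples X P' x h P ↔
          m = 0 ∧ w = v ∧
          arPoly φ = 1 - Polynomial.C a₁ * Polynomial.X - Polynomial.C a₂ * Polynomial.X ^ 2 ∧
          maPoly θ = 1 + Polynomial.C θ₁ * Polynomial.X)) := by
  have hq : flowQ γ α h ≠ 0 := h12
  have hh' : (0 : ℝ) < h := by exact_mod_cast hh
  have hcflow : ∀ j : ℕ, c j = σ ^ 2 / (2 * α * γ) * flowP γ α (j * h) := fun j => by
    rw [hc, hsol.sampledAutocov_eq hγ hα hh hq]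
  have hc0 : c 0 = σ ^ 2 / (2 * α * γ) := by rw [hcflow]; simp [flowP_zero]
  simp_rw [← hc0] at hcflow
  have hc0pos : 0 < c 0 := by rw [hc0]; positivity
  have hc1 : c 1 = c 0 * flowP γ α h := by rw [hcflow]; simp
  have hc2 : c 2 = c 0 * flowP γ α (h + h) := by
    rw [hcflow]; congr 2; push_cast; ring
  have hrec : ∀ n, c (n + 2) = a₁ * c (n + 1) + a₂ * c n := fun n => by
    have := (recursion_of_row (h : ℝ) (n * h) 1 0 ha₁ ha₂).1
    simp only [rowA, one_mul, zero_mul, add_zero] at this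
    rw [hcflow, hcflow (n + 1), hcflow n,
      show ((n + 2 : ℕ) : ℝ) * h = n * h + h + h by push_cast; ring,
      show ((n + 1 : ℕ) : ℝ) * h = n * h + h by push_cast; ring, this]
    ring
  have hroot : ∀ z : ℂ, ‖z‖ ≤ 1 → 1 - a₁ * z - a₂ * z ^ 2 ≠ 0 :=
    langevin_causal hγ hα hh' hq ha₁ ha₂
  have ha₂' : 1 + a₂ ≠ 0 := by
    have : Real.exp (-γ * h) < 1 := Real.exp_lt_one_iff.2 (by nlinarith)
    rw [ha₂]; intro h0; linarith
  obtain ⟨θ₁, v, hθ, hv, hv1, hv2⟩ := exists_ma_parameters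
    (langevin_two_mul_abs_lt hγ hα hh' hq ha₁ ha₂ hc0pos hc1 hc2)
  have hv0 : (v : ℝ) * (1 + θ₁ ^ 2 + θ₁ * a₁) = c 0 - c 1 * a₁ - c 2 * a₂ := by
    linear_combination hv1 + a₁ * hv2
  have hcop := isCoprime_of_sq_ne hθ ha₂' (hrec 0) hv0 hv2
    (langevin_sq_ne hα hq hc0pos hc1 hc2)
  have hc₀ : c 0 - a₁ * c 1 - a₂ * c 2 = v * (1 + θ₁ ^ 2 + θ₁ * a₁) := by
    rw [hv0]; ring
  have hc₁ : c 1 - a₁ * c 0 - a₂ * c 1 = v * θ₁ := by rw [hv2]; ring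
  have hx := hsol.memLp_x hγ hα hh hq
  have hx0 : ∫ ω, x 0 ω ∂P = 0 := by
    simpa using ((hsol.isCenteredGaussianProcess_sampled hγ hα hh hq).eval 0).integral_eq_zero
  have hcausal : IsCausal ![a₁, a₂] := isCausal_two_iff.2 hroot
  have hinv : IsInvertibleMA ![θ₁] := isInvertibleMA_one hθ
  have hsolution := isARMASolution_armaSeries (θ := θ₁) (v := v) hroot
  refine ⟨⟨fun k j => ?_, hc0, fun l₁ l₂ hne h₁ h₂ j => ?_, fun hd j => ?_⟩,
    θ₁, v, hθ, hv, hv0, hv2, fun θ' v' hθ' e₀ e₁ => ?_, hcausal, hinv, ?_, ?_⟩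
  · rw [hsol.covariance_sampled, hc]
  · rw [hcflow, Complex.ofReal_mul, flowP_eq_of_ne hne h₁ h₂]
    push_cast
    simp only [mul_assoc]
  · rw [hcflow, flowP_eq_of_discrim_eq_zero hd]
    simp only [mul_assoc]
  · have hr : (v : ℝ) * (1 + θ₁ ^ 2) ≠ 0 := by positivity
    exact ma_parameters_unique hθ hθ' hr (by linear_combination e₀ - hv0 - a₁ * (e₁ - hv2))
      (by rw [e₁, hv2])
  · -- In the recursion to be shown, the innovation of `X (n + 2)` is called `W n`.
    refine ⟨ℤ → ℝ, inferInstance, noiseMeasure v, inferInstance, armaSeries a₁ a₂ θ₁,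
      fun n ω => ω (n + 2), hsolution.isARMA hcop, (isGaussianNoise_eval v).shift 2, fun n => ?_,
      hsolution.sameLawAsSamples hsol hγ hα hh hq hroot ha₂' hc hc₀ hc₁ hrec⟩
    filter_upwards [hsolution.recursion] with ω hω
    have := hω (n + 2)
    rw [show n + 2 - 1 = n + 1 by ring, show n + 2 - 2 = n by ring] at this
    rw [show n - 1 + 2 = n + 1 by ring]
    linarith
  · intro Ω' _ P' _ p q φ θ w m X hX hφ hθ''
    constructor
    · intro hlaw
      obtain rfl : m = 0 := hlaw.mean_eq_zero hx hx0 hX hφ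
      simp only [sub_zero] at hX
      obtain ⟨hX2, hXcov⟩ := hlaw.memLp_and_covariance hX.stationary hx
      obtain ⟨hw, har, hma⟩ := hX.eq_of_covariance_eq hφ hθ'' (hsolution.isARMA hcop) hcausal hinv
        hv.ne' hX2 (fun n => ((hsolution.isCenteredGaussianProcess hroot).eval n).memLp_two)
        fun i j => by rw [hXcov, hsolution.covariance_eq hroot ha₂' hc₀ hc₁ hrec, hc]
      exact ⟨rfl, hw, by rw [har, arPoly_two], by rw [hma, maPoly_one]⟩
    · rintro ⟨rfl, rfl, har, hma⟩
      simp only [sub_zero] at hX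
      obtain ⟨W, hW⟩ := IsARMASolution.of_isARMA hX har hma
      exact hW.sameLawAsSamples hsol hγ hα hh hq hroot ha₂' hc hc₀ hc₁ hrec
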